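/- Let $\mathcal{H}=\{z\in\mathbb{C}\mid \operatorname{Im} z>0\}$ and let $\mathrm{Hol}$ be the $\mathbb{C}$-algebra of holomorphic functions on $\mathcal{H}$. Let $E_k=1+O(q)$, $q=e^{2\pi i z}$, be the normalised Eisenstein series of weight $k$ on $\mathrm{SL}(2,\mathbb{Z})$, and for $n\in\mathbb{R}$ let $D_n f=\frac{1}{2\pi i}\frac{df}{dz}-\frac{n}{12}E_2f$ be the Ramanujan–Serre operator. Let $H=\bigoplus_{n\in\mathbb{R}}H_n$, where each $H_n$ is a copy of $\mathrm{Hol}$, with elements written $(f,n)$; $H$ is a graded $\mathbb{C}$-algebra under $(f,n)(g,m)=(fg,n+m)$. Define $\mathbb{C}$-linear endomorphisms of $H$ by $$\delta(f,n)=(D_nf,n+2),\qquad e_4(f,n)=(E_4f,n+4),\qquad e_6(f,n)=(E_6f,n+6).$$ Let $\mathcal{R}\subset\mathrm{End}_{\mathbb{C}}(H)$ be the $\mathbb{C}$-subalgebra generated by $\delta,e_4,e_6$ (the algebra of modular linear differential operators), and for $i\in\mathbb{Z}$ let $\mathcal{R}_i$ be the set of $a\in\mathcal{R}$ with $a(H_n)\subset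 H_{n+i}$ for all $n\in\mathbb{R}$. Let $\mathcal{M}=\bigoplus_{k}\mathcal{M}_k$ be the graded algebra of holomorphic modular forms on $\mathrm{SL}(2,\mathbb{Z})$, and let $\delta$ also denote the derivation of $\mathcal{M}$ given by $D_k:\mathcal{M}_k\to\mathcal{M}_{k+2}$ on $\mathcal{M}_k$. Let $\mathcal{M}[\xi;1,\delta]$ be the skew polynomial (Ore) ring: its elements are the finite sums $\sum_i a_i\xi^i$ with uniquely determined $a_i\in\mathcal{M}$, and its multiplication is determined by $\xi a=a\xi+\delta(a)$ for $a\in\mathcal{M}$. Give elements of $\mathcal{M}_k$ weight $k$ and $\xi$ weight $2$. **Theorem.** The algebra $\mathcal{M}=\mathbb{C}[E_4,E_6]$ is the polynomial ring in $E_4$ and $E_6$, and $\mathcal{M}[\xi;1,\delta]$ is a graded $\mathbb{C}$-algebra with respect to the weights above. There is an isomorphism of $\mathbb{C}$-algebras $\mathcal{M}[\xi;1,\delta]\to\mathcal{R}$ that sends $E_4,E_6,\xi$ to $e_4,e_6,\delta$ respectively, and under which, for every $n\in\mathbb{Z}$, the part of weight $n$ corresponds to $\mathcal{R}_n$. Moreover,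 $\mathcal{R}$ is left and right Noetherian, and it is a left and right Ore domain. -/

import Mathlib

open scoped UpperHalfPlane MatrixGroups ModularForm Manifold DirectSum

/-! ### The skew polynomial ring `A[ξ; 1, d]` -/

section SkewPolynomials

variable {k A : Type*} [CommRing k] [CommRing A] [Algebra k A]

/-- The skew polynomial ring `A[ξ; 1, d]` of a derivation `d` of a commutative `k`-algebra `A`:
finite sums `∑ aᵢ ξ ^ i`, stored by their coefficients `i ↦ aᵢ`, with the multiplication
determined by `ξ a = a ξ + d a`. -/
def SkewPolynomialRing (_d : Derivation k A A) : Type _ := ℕ →₀ A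

namespace SkewPolynomialRing

variable (d : Derivation k A A)

noncomputable instance : AddCommGroup (SkewPolynomialRing d) :=
  inferInstanceAs (AddCommGroup (ℕ →₀ A))

noncomputable instance : Module A (SkewPolynomialRing d) :=
  inferInstanceAs (Module A (ℕ →₀ A))

noncomputable instance : Module k (SkewPolynomialRing d) :=
  inferInstanceAs (Module k (ℕ →₀ A))

instance : IsScalarTower k A (SkewPolynomialRing d) :=
  inferInstanceAs (IsScalarTower k A (ℕ →₀ A))

/-- The element `a ξ ^ i`. -/
noncomputable def monomial (i : ℕ) (a : A) : SkewPolynomialRing d :=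
  (Finsupp.single i a : ℕ →₀ A)

/-- The coefficient of `ξ ^ i`. -/
def coeff (i : ℕ) : SkewPolynomialRing d →ₗ[A] A :=
  (Finsupp.lapply i : (ℕ →₀ A) →ₗ[A] A)

/-- Left multiplication by `ξ`, that is `∑ bⱼ ξ ^ j ↦ ∑ (bⱼ ξ ^ (j + 1) + d bⱼ ξ ^ j)`. -/
noncomputable def xiMul : SkewPolynomialRing d →ₗ[k] SkewPolynomialRing d :=
  (Finsupp.lmapDomain A k (· + 1) + Finsupp.mapRange.linearMap d.toLinearMap :
    (ℕ →₀ A) →ₗ[k] (ℕ →₀ A))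

/-- `(∑ aᵢ ξ ^ i) * q = ∑ aᵢ • ξ ^ i q`. -/
noncomputable instance : Mul (SkewPolynomialRing d) where
  mul p q := Finsupp.sum (show ℕ →₀ A from p) fun i a ↦ a • (xiMul d ^ i) q

noncomputable instance : One (SkewPolynomialRing d) where
  one := monomial d 0 1

variable {d}

theorem mul_def (p q : SkewPolynomialRing d) :
    p * q = Finsupp.sum (show ℕ →₀ A from p) fun i a ↦ a • (xiMul d ^ i) q := rfl

theorem one_def : (1 : SkewPolynomialRing d) = monomial d 0 1 := rfl

theorem induction_on {P : SkewPolynomialRing d → Prop} (p : SkewPolynomialRing d)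
    (h0 : P 0) (hadd : ∀ p q, P p → P q → P (p + q)) (hm : ∀ i a, P (monomial d i a)) : P p :=
  Finsupp.induction_linear (motive := P) p h0 hadd hm

theorem xiMul_monomial (i : ℕ) (a : A) :
    xiMul d (monomial d i a) = monomial d (i + 1) a + monomial d i (d a) := by
  change (Finsupp.lmapDomain A k (· + 1) + Finsupp.mapRange.linearMap d.toLinearMap :
    (ℕ →₀ A) →ₗ[k] (ℕ →₀ A)) (Finsupp.single i a) = _
  rw [LinearMap.add_apply]
  simp [monomial]
  rfl

theorem smul_monomial (a : A) (i : ℕ) (b : A) : a • monomial d i b = monomial d i (a * b) := by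
  change a • (Finsupp.single i b : ℕ →₀ A) = Finsupp.single i (a * b)
  simp

theorem monomial_add (i : ℕ) (a b : A) :
    monomial d i (a + b) = monomial d i a + monomial d i b :=
  Finsupp.single_add i a b

theorem monomial_zero (i : ℕ) : monomial d i 0 = 0 := Finsupp.single_zero i

theorem xiMul_smul (a : A) (p : SkewPolynomialRing d) :
    xiMul d (a • p) = a • xiMul d p + d a • p := by
  induction p using induction_on with
  | h0 => simp
  | hadd p q hp hq => simp only [smul_add, map_add, hp, hq]; abel
  | hm i b =>
    simp only [smul_monomial, xiMul_monomial, smul_add, Derivation.leibniz, smul_eq_mul,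
      monomial_add, mul_comm b]
    abel

theorem add_mul' (p q r : SkewPolynomialRing d) : (p + q) * r = p * r + q * r :=
  Finsupp.sum_add_index' (by simp) (by simp [add_smul])

theorem mul_add' (p q r : SkewPolynomialRing d) : p * (q + r) = p * q + p * r := by
  simp only [mul_def, map_add, smul_add]
  exact Finsupp.sum_add

theorem zero_mul' (p : SkewPolynomialRing d) : 0 * p = 0 := Finsupp.sum_zero_index

theorem mul_zero' (p : SkewPolynomialRing d) : p * 0 = 0 := by
  simp only [mul_def, map_zero, smul_zero]
  exact Finset.sum_const_zero

theorem monomial_mul (i : ℕ) (a : A) (q : SkewPolynomialRing d) :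
    monomial d i a * q = a • (xiMul d ^ i) q :=
  Finsupp.sum_single_index (by simp)

theorem smul_mul' (a : A) (p q : SkewPolynomialRing d) : (a • p) * q = a • (p * q) := by
  induction p using induction_on with
  | h0 => simp [zero_mul']
  | hadd p p' hp hp' => simp only [smul_add, add_mul', hp, hp']
  | hm i b => simp only [smul_monomial, monomial_mul, mul_smul]

theorem xiMul_mul (p q : SkewPolynomialRing d) : xiMul d p * q = xiMul d (p * q) := by
  induction p using induction_on with
  | h0 => simp [zero_mul']
  | hadd p p' hp hp' => simp only [map_add, add_mul', hp, hp']
  | hm i b =>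
    simp only [xiMul_monomial, add_mul', monomial_mul, xiMul_smul, pow_succ', Module.End.mul_apply]

theorem xiMul_pow_mul (i : ℕ) (p q : SkewPolynomialRing d) :
    (xiMul d ^ i) p * q = (xiMul d ^ i) (p * q) := by
  induction i with
  | zero => simp
  | succ i ih => simp only [pow_succ', Module.End.mul_apply, xiMul_mul, ih]

theorem mul_assoc' (p q r : SkewPolynomialRing d) : p * q * r = p * (q * r) := by
  induction p using induction_on with
  | h0 => simp [zero_mul']
  | hadd p p' hp hp' => simp only [add_mul', hp, hp']
  | hm i b => simp only [monomial_mul, smul_mul', xiMul_pow_mul]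

theorem xiMul_pow_one (i : ℕ) : (xiMul d ^ i) 1 = monomial d i 1 := by
  induction i with
  | zero => rfl
  | succ i ih =>
    rw [pow_succ', Module.End.mul_apply, ih, xiMul_monomial, Derivation.map_one_eq_zero,
      monomial_zero, add_zero]

theorem mul_one' (p : SkewPolynomialRing d) : p * 1 = p := by
  induction p using induction_on with
  | h0 => simp [zero_mul']
  | hadd p p' hp hp' => simp only [add_mul', hp, hp']
  | hm i b => simp only [monomial_mul, xiMul_pow_one, smul_monomial, mul_one]

theorem one_mul' (p : SkewPolynomialRing d) : 1 * p = p := by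
  simp [one_def, monomial_mul]

noncomputable instance : Ring (SkewPolynomialRing d) :=
  { (inferInstance : AddCommGroup (SkewPolynomialRing d)),
    (inferInstance : Mul (SkewPolynomialRing d)),
    (inferInstance : One (SkewPolynomialRing d)) with
    left_distrib := mul_add'
    right_distrib := add_mul'
    zero_mul := zero_mul'
    mul_zero := mul_zero'
    mul_assoc := mul_assoc'
    one_mul := one_mul'
    mul_one := mul_one' }

theorem mul_smul' (c : k) (p q : SkewPolynomialRing d) : p * (c • q) = c • (p * q) := by
  induction p using induction_on with
  | h0 => simp
  | hadd p p' hp hp' => simp only [add_mul, hp, hp', smul_add]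
  | hm i b => simp only [monomial_mul, map_smul, smul_comm b c]

noncomputable instance : Algebra k (SkewPolynomialRing d) :=
  Algebra.ofModule
    (fun c p q ↦ by rw [← algebraMap_smul A c p, smul_mul', algebraMap_smul])
    mul_smul'

variable (d)

/-- The inclusion of the coefficients. -/
noncomputable def C : A →ₐ[k] SkewPolynomialRing d :=
  AlgHom.ofLinearMap (Finsupp.lsingle 0 : A →ₗ[k] (ℕ →₀ A)) rfl fun a b ↦ by
    change monomial d 0 (a * b) = monomial d 0 a * monomial d 0 b
    simp [monomial_mul, smul_monomial]

/-- The variable `ξ`. -/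
noncomputable def xi : SkewPolynomialRing d := monomial d 1 1

theorem xi_mul_C (a : A) : xi d * C d a = C d a * xi d + C d (d a) := by
  change monomial d 1 1 * monomial d 0 a = monomial d 0 a * monomial d 1 1 + monomial d 0 (d a)
  simp [monomial_mul, xiMul_monomial, smul_monomial]

theorem C_mul_xi_pow (a : A) (i : ℕ) : C d a * xi d ^ i = monomial d i a := by
  have h : ∀ i : ℕ, xi d ^ i = monomial d i 1 := by
    intro i
    induction i with
    | zero => rfl
    | succ i ih =>
      rw [pow_succ', ih, xi, monomial_mul, pow_one, xiMul_monomial, Derivation.map_one_eq_zero,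
        monomial_zero, add_zero, one_smul]
  change monomial d 0 a * _ = _
  simp [h, monomial_mul, smul_monomial]

/-- The weight decomposition of the graded skew polynomial ring `A[ξ; 1, d]`, when
`A = ⨁ 𝒜 n` and `d` raises weights by `m`: elements of `𝒜 n` have weight `n` and `ξ` has
weight `m`. -/
def weightPiece (𝒜 : ℤ → Submodule k A) (m n : ℤ) : Submodule k (SkewPolynomialRing d) where
  carrier := {p | ∀ i : ℕ, coeff d i p ∈ 𝒜 (n - i * m)}
  zero_mem' i := by simp
  add_mem' hp hq i := by simpa using add_mem (hp i) (hq i)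
  smul_mem' c p hp i := (𝒜 (n - i * m)).smul_mem c (hp i)

end SkewPolynomialRing

end SkewPolynomials

/-! ### Left and right Ore domains -/

/-- A left Ore domain: a domain whose nonzero elements form a left Ore set. -/
def IsLeftOreDomain (R : Type*) [Ring R] : Prop :=
  IsDomain R ∧ Nonempty (OreLocalization.OreSet (nonZeroDivisors R))

/-- A right Ore domain: a ring whose opposite is a left Ore domain. -/
def IsRightOreDomain (R : Type*) [Ring R] : Prop :=
  IsLeftOreDomain Rᵐᵒᵖ

/-! ### Modular linear differential operators -/

namespace MLDO

/-- The holomorphic functions on the upper half plane, as an algebra under pointwise operations. -/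
def holSubalgebra : Subalgebra ℂ (ℍ → ℂ) where
  carrier := {f | MDiff f}
  mul_mem' hf hg := MDifferentiable.mul hf hg
  add_mem' hf hg := MDifferentiable.add hf hg
  algebraMap_mem' _ := mdifferentiable_const

/-- The algebra `Hol` of holomorphic functions on the upper half plane, as a type. -/
def Hol : Type := holSubalgebra

noncomputable instance : CommRing Hol := inferInstanceAs (CommRing holSubalgebra)

noncomputable instance : Algebra ℂ Hol := inferInstanceAs (Algebra ℂ holSubalgebra)

/-- The Ramanujan-Serre operator `f ↦ f' - (n / 12) E₂ f` on holomorphic functions, where `f'`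
is the derivative of `f` divided by `2 π i`. -/
noncomputable def serreHol (n : ℝ) : Hol →ₗ[ℂ] Hol where
  toFun f := ⟨Derivative.serreDerivative n f.1,
    Derivative.serreDerivative_mdifferentiable _ f.2⟩
  map_add' f g := Subtype.ext (Derivative.serreDerivative_add _ _ _ f.2 g.2)
  map_smul' c f := Subtype.ext (Derivative.serreDerivative_smul _ c _ f.2)

/-- A modular form, as a holomorphic function. -/
def toHol {k : ℤ} (f : ModularForm 𝒮ℒ k) : Hol := ⟨f, f.holo'⟩

/-- The graded algebra `H = ⨁_{n ∈ ℝ} Hol`, with `(f, n) (g, m) = (f g, n + m)`. -/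
def H : Type := ⨁ _ : ℝ, Hol

noncomputable instance : CommRing H := inferInstanceAs (CommRing (⨁ _ : ℝ, Hol))

noncomputable instance : Algebra ℂ H := inferInstanceAs (Algebra ℂ (⨁ _ : ℝ, Hol))

/-- The element `(f, n)` of `H`. -/
noncomputable def ofWeight (n : ℝ) : Hol →ₗ[ℂ] H :=
  (DirectSum.lof ℂ ℝ (fun _ ↦ Hol) n : Hol →ₗ[ℂ] ⨁ _ : ℝ, Hol)

theorem ofWeight_mul_ofWeight (n m : ℝ) (f g : Hol) :
    ofWeight n f * ofWeight m g = ofWeight (n + m) (f * g) :=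
  DirectSum.of_mul_of (A := fun _ : ℝ ↦ Hol) f g

/-- The endomorphism `(f, n) ↦ (φₙ f, n + i)` of `H`. -/
noncomputable def homogeneousEnd (i : ℝ) (φ : ℝ → Hol →ₗ[ℂ] Hol) : Module.End ℂ H :=
  (DirectSum.toModule ℂ ℝ H fun n ↦ ofWeight (n + i) ∘ₗ φ n : (⨁ _ : ℝ, Hol) →ₗ[ℂ] H)

theorem homogeneousEnd_ofWeight (i : ℝ) (φ : ℝ → Hol →ₗ[ℂ] Hol) (n : ℝ) (f : Hol) :
    homogeneousEnd i φ (ofWeight n f) = ofWeight (n + i) (φ n f) :=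
  DirectSum.toModule_lof ℂ (M := fun _ : ℝ ↦ Hol) n f

/-- `δ (f, n) = (Dₙ f, n + 2)`. -/
noncomputable def delta : Module.End ℂ H := homogeneousEnd 2 serreHol

/-- `e₄ (f, n) = (E₄ f, n + 4)`. -/
noncomputable def e₄ : Module.End ℂ H :=
  homogeneousEnd 4 fun _ ↦ LinearMap.mulLeft ℂ (toHol ModularForm.E₄)

/-- `e₆ (f, n) = (E₆ f, n + 6)`. -/
noncomputable def e₆ : Module.End ℂ H :=
  homogeneousEnd 6 fun _ ↦ LinearMap.mulLeft ℂ (toHol ModularForm.E₆)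

/-- The endomorphisms of `H` of weight `i`: those mapping `Hₙ` into `Hₙ₊ᵢ` for all `n`. -/
def endWeight (i : ℝ) : Submodule ℂ (Module.End ℂ H) where
  carrier := {φ | ∀ (n : ℝ) (f : Hol), φ (ofWeight n f) ∈ LinearMap.range (ofWeight (n + i))}
  zero_mem' _ _ := by simp
  add_mem' hφ hψ n f := add_mem (hφ n f) (hψ n f)
  smul_mem' c _ hφ n f := Submodule.smul_mem _ c (hφ n f)

/-- The MLDO algebra `ℛ`, generated by `δ`, `e₄` and `e₆`. -/
noncomputable def mldoAlgebra : Subalgebra ℂ (Module.End ℂ H) :=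
  Algebra.adjoin ℂ {delta, e₄, e₆}

/-- The space `ℛᵢ` of modular linear differential operators of weight `i`. -/
noncomputable def mldoWeight (i : ℤ) : Submodule ℂ mldoAlgebra :=
  (endWeight i).comap mldoAlgebra.val.toLinearMap

/-! ### The algebra of modular forms and its Ramanujan-Serre derivation -/

open UpperHalfPlane in
theorem isBoundedAtImInfty_normalizedDeriv {f : ℍ → ℂ} (hf : MDiff f)
    (hb : IsBoundedAtImInfty f) :
    IsBoundedAtImInfty (Derivative.normalizedDerivOfComplex f) := by
  rw [isBoundedAtImInfty_iff] at hb ⊢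
  obtain ⟨M, B, hMB⟩ := hb
  refine ⟨‖(2 * Real.pi * Complex.I : ℂ)⁻¹‖ * (M / (1 / 2)), max B 0 + 1, fun z hz ↦ ?_⟩
  rw [Derivative.normalizedDerivOfComplex, norm_mul]
  have him : ∀ w ∈ Metric.closedBall (z : ℂ) (1 / 2), max B 0 < w.im := by
    intro w hw
    have h1 : |(w - z).im| ≤ 1 / 2 :=
      (Complex.abs_im_le_norm _).trans (by simpa [dist_eq_norm] using hw)
    have h2 := (abs_le.mp h1).1
    rw [Complex.sub_im, coe_im] at h2
    linarith
  have hd : DifferentiableOn ℂ (f ∘ ofComplex) upperHalfPlaneSet :=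
    UpperHalfPlane.mdifferentiable_iff.mp hf
  have hsub : Metric.closedBall (z : ℂ) (1 / 2) ⊆ upperHalfPlaneSet := fun w hw ↦
    lt_of_le_of_lt (le_max_right _ _) (him w hw)
  refine mul_le_mul_of_nonneg_left ?_ (norm_nonneg _)
  refine Complex.norm_deriv_le_of_forall_mem_sphere_norm_le (by norm_num) ?_ fun w hw ↦ ?_
  · refine (hd.mono ?_).diffContOnCl
    rwa [closure_ball _ (by norm_num)]
  · have hw' := Metric.sphere_subset_closedBall hw
    have hpos : 0 < w.im := lt_of_le_of_lt (le_max_right _ _) (him w hw')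
    rw [Function.comp_apply, ofComplex_apply_of_im_pos hpos]
    exact hMB _ (le_trans (le_max_left _ _) (him w hw').le)

theorem isBoundedAtImInfty_serreDerivative (n : ℂ) {f : ℍ → ℂ} (hf : MDiff f)
    (hb : UpperHalfPlane.IsBoundedAtImInfty f) :
    UpperHalfPlane.IsBoundedAtImInfty (Derivative.serreDerivative n f) := by
  have h := (isBoundedAtImInfty_normalizedDeriv hf hb).sub
    ((EisensteinSeries.isBoundedAtImInfty_E2.mul hb).const_mul_left (n * 12⁻¹))
  refine h.congr_left fun z ↦ ?_
  simp [mul_assoc]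

/-- The Ramanujan-Serre operator maps modular forms of weight `k` to modular forms of
weight `k + 2`. -/
noncomputable def serreForm (k : ℤ) : ModularForm 𝒮ℒ k →ₗ[ℂ] ModularForm 𝒮ℒ (k + 2) where
  toFun f :=
    { toFun := Derivative.serreDerivative k f
      slash_action_eq' := by
        rintro _ ⟨γ, rfl⟩
        exact Derivative.serreDerivative_slash_invariant f.holo'
          (f.slash_action_eq' _ ⟨γ, rfl⟩)
      holo' := Derivative.serreDerivative_mdifferentiable _ f.holo'
      bdd_at_cusps' := by
        intro c hc
        rw [OnePoint.isBoundedAt_iff_forall_SL2Z hc]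
        intro γ _
        have h : (f : ℍ → ℂ) ∣[k] γ = f := f.slash_action_eq' _ ⟨γ, rfl⟩
        have h' : Derivative.serreDerivative k f ∣[k + 2] γ = Derivative.serreDerivative k f :=
          Derivative.serreDerivative_slash_invariant f.holo' h
        change UpperHalfPlane.IsBoundedAtImInfty (Derivative.serreDerivative k f ∣[k + 2] γ)
        rw [h']
        exact isBoundedAtImInfty_serreDerivative _ f.holo' (ModularFormClass.bdd_at_infty f) }
  map_add' f g := DFunLike.coe_injective
    (Derivative.serreDerivative_add _ _ _ f.holo' g.holo')
  map_smul' c f := DFunLike.coe_injective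
    (Derivative.serreDerivative_smul _ c _ f.holo')

/-- The graded algebra `ℳ` of modular forms on `SL(2, ℤ)`, the direct sum of the spaces of
modular forms of weight `k` (which vanish for odd `k`). -/
abbrev ModularFormAlgebra : Type := ⨁ k : ℤ, ModularForm 𝒮ℒ k

/-- A modular form of weight `k`, as an element of `ℳ`. -/
noncomputable def ofForm (k : ℤ) : ModularForm 𝒮ℒ k →ₗ[ℂ] ModularFormAlgebra :=
  DirectSum.lof ℂ ℤ (fun k ↦ ModularForm 𝒮ℒ k) k

/-- The homogeneous part of weight `k` of `ℳ`. -/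
noncomputable def formWeight (k : ℤ) : Submodule ℂ ModularFormAlgebra :=
  LinearMap.range (ofForm k)

/-- The linear map on `ℳ` that acts on modular forms of weight `k` by `D_k`. -/
noncomputable def serreLinear : ModularFormAlgebra →ₗ[ℂ] ModularFormAlgebra :=
  DirectSum.toModule ℂ ℤ ModularFormAlgebra fun k ↦ ofForm (k + 2) ∘ₗ serreForm k

theorem serreLinear_ofForm (k : ℤ) (f : ModularForm 𝒮ℒ k) :
    serreLinear (ofForm k f) = ofForm (k + 2) (serreForm k f) :=
  DirectSum.toModule_lof ℂ k f

theorem ofForm_mul_ofForm {k l : ℤ} (f : ModularForm 𝒮ℒ k) (g : ModularForm 𝒮ℒ l) :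
    ofForm k f * ofForm l g = ofForm (k + l) (f.mul g) :=
  DirectSum.of_mul_of f g

theorem ofForm_eq_ofForm {k l : ℤ} (h : k = l) (f : ModularForm 𝒮ℒ k) (g : ModularForm 𝒮ℒ l)
    (hfg : (f : ℍ → ℂ) = g) : ofForm k f = ofForm l g := by
  subst h
  rw [DFunLike.coe_injective hfg]

theorem serreLinear_leibniz (a b : ModularFormAlgebra) :
    serreLinear (a * b) = a • serreLinear b + b • serreLinear a := by
  simp only [smul_eq_mul]
  induction a using DirectSum.induction_on with
  | zero => simp
  | add a a' ha ha' => simp only [add_mul, map_add, mul_add, ha, ha']; abel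
  | of k f =>
    induction b using DirectSum.induction_on with
    | zero => simp
    | add b b' hb hb' => simp only [add_mul, map_add, mul_add, hb, hb']; abel
    | of l g =>
      change serreLinear (ofForm k f * ofForm l g) =
        ofForm k f * serreLinear (ofForm l g) + ofForm l g * serreLinear (ofForm k f)
      rw [ofForm_mul_ofForm, serreLinear_ofForm, serreLinear_ofForm, serreLinear_ofForm,
        ofForm_mul_ofForm, ofForm_mul_ofForm,
        ofForm_eq_ofForm (by ring) (f.mul (serreForm l g))
          (ModularForm.mcast (by ring) (f.mul (serreForm l g)) : ModularForm 𝒮ℒ (k + l + 2)) rfl,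
        ofForm_eq_ofForm (by ring) (g.mul (serreForm k f))
          (ModularForm.mcast (by ring) (g.mul (serreForm k f)) : ModularForm 𝒮ℒ (k + l + 2)) rfl,
        ← map_add]
      congr 1
      refine DFunLike.coe_injective ?_
      have h := Derivative.serreDerivative_mul k l f g f.holo' g.holo'
      have h' : Derivative.serreDerivative ((k + l : ℤ) : ℂ) ((f : ℍ → ℂ) * g) =
          (f : ℍ → ℂ) * Derivative.serreDerivative l g +
            (g : ℍ → ℂ) * Derivative.serreDerivative k f := by
        push_cast
        rw [h]
        ring
      exact h'

/-- The derivation `δ` of `ℳ`, acting on modular forms of weight `k` by `D_k`. -/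
noncomputable def serreDerivation : Derivation ℂ ModularFormAlgebra ModularFormAlgebra :=
  Derivation.mk' serreLinear serreLinear_leibniz

/-- The Eisenstein series `E₄` as an element of `ℳ`. -/
noncomputable def formE₄ : ModularFormAlgebra := ofForm 4 ModularForm.E₄

/-- The Eisenstein series `E₆` as an element of `ℳ`. -/
noncomputable def formE₆ : ModularFormAlgebra := ofForm 6 ModularForm.E₆

end MLDO

/-! Multiplication by a modular form a satisfies `delta` ∘ a = a ∘ `delta` + δ(a) on `H`, by the
Leibniz rule for `delta`. The universal property `lift` therefore gives a homomorphism `mldoHom`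
from ℳ[ξ; 1, δ] to the endomorphisms of `H`, and its image is ℛ because E₄ and E₆ generate ℳ.

The main point is faithfulness (`action_injective`). The algebra `H` is much larger than ℳ: it
contains the coordinate z in weight 0, and D₀ z = 1/(2πi) is a unit of `H`. The commutator with
multiplication by z turns a skew polynomial of degree n ≥ 1 with leading coefficient a into one of
degree n - 1 with leading coefficient n a δ(z). An element of the kernel thus yields kernel elements
of lower and lower degree, down to a nonzero multiplication operator, which does not kill 1.

That E₄ and E₆ generate ℳ is the classical induction on the weight: remove the constant term with a
monomial, then divide by the discriminant. Their independence comes from z = i, where E₆ vanishes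
and E₄ does not: every relation is divisible by the second variable, and E₆ can be cancelled.

Weights are preserved by `mldoHom`; conversely, operators of different weights are independent, so
injectivity detects the weight. Leading coefficients multiply, which makes the skew polynomial ring
a domain and lets the Hilbert basis argument run. The Ore conditions then follow from Noetherianity.
-/

namespace SkewPolynomialRing

variable {k A : Type*} [CommRing k] [CommRing A] [Algebra k A] {d : Derivation k A A}

/-! ### Coefficients of skew polynomials -/

@[ext]
theorem ext {p q : SkewPolynomialRing d} (h : ∀ i, coeff d i p = coeff d i q) : p = q :=
  Finsupp.ext h

theorem coeff_monomial (i j : ℕ) (a : A) :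
    coeff d i (monomial d j a) = if j = i then a else 0 :=
  Finsupp.single_apply

theorem coeff_smul (i : ℕ) (a : A) (p : SkewPolynomialRing d) :
    coeff d i (a • p) = a * coeff d i p := by
  simp

theorem coeff_xiMul_zero (p : SkewPolynomialRing d) :
    coeff d 0 (xiMul d p) = d (coeff d 0 p) := by
  induction p using induction_on with
  | h0 => simp
  | hadd p q hp hq => simp only [map_add, hp, hq]
  | hm i a =>
    rw [xiMul_monomial, map_add, coeff_monomial, coeff_monomial, coeff_monomial]
    split_ifs <;> simp_all

theorem coeff_xiMul_succ (i : ℕ) (p : SkewPolynomialRing d) :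
    coeff d (i + 1) (xiMul d p) = coeff d i p + d (coeff d (i + 1) p) := by
  induction p using induction_on with
  | h0 => simp
  | hadd p q hp hq => simp only [map_add, hp, hq]; abel
  | hm j a =>
    rw [xiMul_monomial, map_add, coeff_monomial, coeff_monomial, coeff_monomial, coeff_monomial]
    split_ifs <;> simp_all

theorem C_mul (a : A) (p : SkewPolynomialRing d) : C d a * p = a • p := by
  change monomial d 0 a * p = _
  rw [monomial_mul, pow_zero, Module.End.one_apply]

theorem xi_mul (p : SkewPolynomialRing d) : xi d * p = xiMul d p := by
  rw [xi, monomial_mul, pow_one, one_smul]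

theorem coeff_C (i : ℕ) (a : A) : coeff d i (C d a) = if 0 = i then a else 0 :=
  coeff_monomial i 0 a

theorem C_injective : Function.Injective (C d) := fun a b h ↦ by
  simpa [coeff_C] using congrArg (coeff d 0) h

instance [Nontrivial A] : Nontrivial (SkewPolynomialRing d) :=
  C_injective.nontrivial

/-! ### Universal property -/

section Lift

variable {B : Type*} [Ring B] [Algebra k B] (f : A →ₐ[k] B) (x : B)

/-- The linear map `∑ aᵢ ξ ^ i ↦ ∑ f aᵢ * x ^ i`. -/
noncomputable def liftLinear : SkewPolynomialRing d →ₗ[k] B :=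
  (Finsupp.lsum k fun i ↦ LinearMap.mulRight k (x ^ i) ∘ₗ f.toLinearMap : (ℕ →₀ A) →ₗ[k] B)

theorem liftLinear_monomial (i : ℕ) (a : A) :
    liftLinear f x (monomial d i a) = f a * x ^ i := by
  change (Finsupp.lsum k fun i ↦ LinearMap.mulRight k (x ^ i) ∘ₗ f.toLinearMap :
    (ℕ →₀ A) →ₗ[k] B) (Finsupp.single i a) = _
  simp

theorem liftLinear_smul (a : A) (p : SkewPolynomialRing d) :
    liftLinear f x (a • p) = f a * liftLinear f x p := by
  induction p using induction_on with
  | h0 => simp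
  | hadd p q hp hq => simp only [smul_add, map_add, hp, hq, mul_add]
  | hm i b => rw [smul_monomial, liftLinear_monomial, liftLinear_monomial, map_mul, mul_assoc]

variable {x} (hx : ∀ a, x * f a = f a * x + f (d a))
include hx

theorem liftLinear_xiMul (p : SkewPolynomialRing d) :
    liftLinear f x (xiMul d p) = x * liftLinear f x p := by
  induction p using induction_on with
  | h0 => simp
  | hadd p q hp hq => simp only [map_add, hp, hq, mul_add]
  | hm i b =>
    rw [xiMul_monomial, map_add, liftLinear_monomial, liftLinear_monomial, liftLinear_monomial,
      ← mul_assoc, hx, pow_succ', ← mul_assoc, add_mul]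

/-- The product p q is built from q by left multiplications by ξ and by coefficients, so
compatibility with these two operations is enough. -/
theorem liftLinear_mul (p q : SkewPolynomialRing d) :
    liftLinear f x (p * q) = liftLinear f x p * liftLinear f x q := by
  have h : ∀ i : ℕ, liftLinear f x ((xiMul d ^ i) q) = x ^ i * liftLinear f x q := by
    intro i
    induction i with
    | zero => simp
    | succ i ih =>
      rw [pow_succ', Module.End.mul_apply, liftLinear_xiMul f hx, ih, pow_succ', mul_assoc]
  induction p using induction_on with
  | h0 => simp
  | hadd p p' hp hp' => simp only [add_mul, map_add, hp, hp']
  | hm i a => rw [monomial_mul, liftLinear_smul, h, liftLinear_monomial, mul_assoc]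

/-- The universal property of `A[ξ; 1, d]`. -/
noncomputable def lift : SkewPolynomialRing d →ₐ[k] B :=
  AlgHom.ofLinearMap (liftLinear f x) (by rw [one_def, liftLinear_monomial]; simp)
    (liftLinear_mul f hx)

theorem lift_monomial (i : ℕ) (a : A) : lift f hx (monomial d i a) = f a * x ^ i :=
  liftLinear_monomial f x i a

theorem lift_C (a : A) : lift f hx (C d a) = f a :=
  (lift_monomial f hx 0 a).trans (by simp)

theorem lift_xi : lift f hx (xi d) = x :=
  (lift_monomial f hx 1 1).trans (by simp)

end Lift

theorem eq_top_of_C_mem_of_xi_mem {T : Subalgebra k (SkewPolynomialRing d)}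
    (hC : ∀ a, C d a ∈ T) (hxi : xi d ∈ T) : T = ⊤ := by
  refine eq_top_iff.mpr fun p _ ↦ ?_
  induction p using induction_on with
  | h0 => exact zero_mem T
  | hadd p q hp hq => exact add_mem (hp trivial) (hq trivial)
  | hm i a => rw [← C_mul_xi_pow]; exact mul_mem (hC a) (pow_mem hxi i)

/-! ### Degrees -/

variable (d) in
/-- The skew polynomials of degree less than `n`. -/
def degreeLT (n : ℕ) : Submodule A (SkewPolynomialRing d) where
  carrier := {p | ∀ i, n ≤ i → coeff d i p = 0}
  zero_mem' _ _ := map_zero _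
  add_mem' hp hq i hi := by rw [map_add, hp i hi, hq i hi, add_zero]
  smul_mem' a p hp i hi := by rw [map_smul, hp i hi, smul_zero]

theorem degreeLT_mono {m n : ℕ} (h : m ≤ n) : degreeLT d m ≤ degreeLT d n :=
  fun _ hp i hi ↦ hp i (h.trans hi)

theorem exists_mem_degreeLT (p : SkewPolynomialRing d) : ∃ n, p ∈ degreeLT d n := by
  induction p using induction_on with
  | h0 => exact ⟨0, zero_mem _⟩
  | hadd p q hp hq =>
    obtain ⟨m, hm⟩ := hp
    obtain ⟨n, hn⟩ := hq
    exact ⟨max m n, add_mem (degreeLT_mono (le_max_left m n) hm)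
      (degreeLT_mono (le_max_right m n) hn)⟩
  | hm i a => exact ⟨i + 1, fun j hj ↦ by rw [coeff_monomial, if_neg (by lia)]⟩

theorem eq_zero_of_mem_degreeLT_zero {p : SkewPolynomialRing d} (hp : p ∈ degreeLT d 0) : p = 0 :=
  ext fun i ↦ by rw [hp i (Nat.zero_le i), map_zero]

theorem mem_degreeLT_of_coeff_eq_zero {n : ℕ} {p : SkewPolynomialRing d}
    (hp : p ∈ degreeLT d (n + 1)) (h : coeff d n p = 0) : p ∈ degreeLT d n := by
  intro i hi
  rcases hi.eq_or_lt with rfl | hi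
  · exact h
  · exact hp i hi

theorem exists_mem_degreeLT_succ_of_ne_zero {p : SkewPolynomialRing d} (hp : p ≠ 0) :
    ∃ n, p ∈ degreeLT d (n + 1) ∧ coeff d n p ≠ 0 := by
  classical
  have h := exists_mem_degreeLT p
  obtain ⟨n, hn⟩ : ∃ n, Nat.find h = n + 1 :=
    Nat.exists_eq_succ_of_ne_zero fun h0 ↦
      hp (eq_zero_of_mem_degreeLT_zero (h0 ▸ Nat.find_spec h))
  refine ⟨n, hn ▸ Nat.find_spec h, fun h' ↦ ?_⟩
  exact Nat.find_min h (m := n) (by lia)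
    (mem_degreeLT_of_coeff_eq_zero (hn ▸ Nat.find_spec h) h')

theorem eq_sum_monomial {n : ℕ} {p : SkewPolynomialRing d} (hp : p ∈ degreeLT d n) :
    p = ∑ i ∈ Finset.range n, monomial d i (coeff d i p) := by
  ext j
  simp only [map_sum, coeff_monomial, Finset.sum_ite_eq', Finset.mem_range]
  split_ifs with h
  · rfl
  · exact hp j (by lia)

theorem xiMul_mem_degreeLT {n : ℕ} {p : SkewPolynomialRing d} (hp : p ∈ degreeLT d n) :
    xiMul d p ∈ degreeLT d (n + 1) := by
  intro i hi
  obtain ⟨i, rfl⟩ : ∃ j, i = j + 1 := ⟨i - 1, by lia⟩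
  rw [coeff_xiMul_succ, hp i (by lia), hp (i + 1) (by lia), map_zero, add_zero]

theorem xiMul_pow_mem_degreeLT {n : ℕ} {p : SkewPolynomialRing d} (hp : p ∈ degreeLT d n)
    (i : ℕ) : (xiMul d ^ i) p ∈ degreeLT d (n + i) := by
  induction i with
  | zero => exact hp
  | succ i ih => rw [pow_succ', Module.End.mul_apply]; exact xiMul_mem_degreeLT ih

/-- The derivation term of `xiMul` does not raise the degree, so only the shift reaches the top
coefficient. -/
theorem coeff_xiMul_pow {n : ℕ} {p : SkewPolynomialRing d} (hp : p ∈ degreeLT d (n + 1))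
    (i : ℕ) : coeff d (n + i) ((xiMul d ^ i) p) = coeff d n p := by
  induction i with
  | zero => rfl
  | succ i ih =>
    rw [pow_succ', Module.End.mul_apply, ← add_assoc, coeff_xiMul_succ, ih,
      xiMul_pow_mem_degreeLT hp i _ (by lia), map_zero, add_zero]

theorem mul_eq_sum (p q : SkewPolynomialRing d) {n : ℕ} (hp : p ∈ degreeLT d n) :
    p * q = ∑ i ∈ Finset.range n, coeff d i p • (xiMul d ^ i) q := by
  rw [mul_def]
  refine Finsupp.sum_of_support_subset _ (fun i hi ↦ ?_) _ (by simp)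
  rw [Finset.mem_range]
  by_contra h
  exact Finsupp.mem_support_iff.mp hi (hp i (by lia))

/-- Since ξ ^ i b = b ξ ^ i + lower terms, without any twist of b, top coefficients multiply as for
ordinary polynomials. The absence of zero divisors follows from this. -/
theorem coeff_mul {m n : ℕ} {p q : SkewPolynomialRing d} (hp : p ∈ degreeLT d (m + 1))
    (hq : q ∈ degreeLT d (n + 1)) : coeff d (m + n) (p * q) = coeff d m p * coeff d n q := by
  rw [mul_eq_sum p q hp, map_sum, Finset.sum_range_succ, Finset.sum_eq_zero, zero_add, coeff_smul,
    add_comm, coeff_xiMul_pow hq]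
  intro i hi
  rw [Finset.mem_range] at hi
  rw [coeff_smul, xiMul_pow_mem_degreeLT hq i _ (by lia), mul_zero]

instance [IsDomain A] : IsDomain (SkewPolynomialRing d) :=
  have : NoZeroDivisors (SkewPolynomialRing d) := ⟨fun {p q} h ↦ by
    by_contra! hpq
    obtain ⟨m, hm, hm'⟩ := exists_mem_degreeLT_succ_of_ne_zero hpq.1
    obtain ⟨n, hn, hn'⟩ := exists_mem_degreeLT_succ_of_ne_zero hpq.2
    have := coeff_mul hm hn
    rw [h, map_zero] at this
    exact mul_ne_zero hm' hn' this.symm⟩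
  NoZeroDivisors.to_isDomain _

/-! ### The Hilbert basis theorem -/

/-- The first n coefficients embed this module into the finite free module A ^ n. -/
instance [IsNoetherianRing A] (n : ℕ) : IsNoetherian A (degreeLT d n) := by
  refine isNoetherian_of_injective
    ((LinearMap.pi fun i : Fin n ↦ coeff d (i : ℕ)) ∘ₗ (degreeLT d n).subtype) fun p q h ↦ ?_
  refine Subtype.ext (ext fun i ↦ ?_)
  rcases lt_or_ge i n with hi | hi
  · exact congrFun h ⟨i, hi⟩
  · rw [p.2 i hi, q.2 i hi]

/-- A left ideal of `A[ξ; 1, d]`, as an `A`-module. -/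
noncomputable def restrictIdeal (I : Ideal (SkewPolynomialRing d)) :
    Submodule A (SkewPolynomialRing d) where
  carrier := I
  zero_mem' := I.zero_mem
  add_mem' := I.add_mem
  smul_mem' a p hp := by rw [← C_mul]; exact I.mul_mem_left _ hp

/-- The coefficients of `ξ ^ n` of the elements of degree at most `n` of a left ideal. -/
noncomputable def leadingIdeal (I : Ideal (SkewPolynomialRing d)) (n : ℕ) : Ideal A :=
  (restrictIdeal I ⊓ degreeLT d (n + 1)).map (coeff d n)

theorem leadingIdeal_mono (I : Ideal (SkewPolynomialRing d)) : Monotone (leadingIdeal I) := by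
  refine monotone_nat_of_le_succ fun n ↦ ?_
  rintro _ ⟨p, ⟨hpI, hp⟩, rfl⟩
  refine ⟨xiMul d p, ⟨?_, xiMul_mem_degreeLT hp⟩, coeff_xiMul_pow hp 1⟩
  rw [← xi_mul]
  exact I.mul_mem_left _ hpI

/-- Let the chain of leading ideals stabilise at N. The elements of I of degree at most N form a
finitely generated A-module, and its generators already generate I: above N every leading
coefficient is that of an element of degree at most N, multiplied by a power of ξ on the left. -/
theorem isNoetherianRing [IsNoetherianRing A] : IsNoetherianRing (SkewPolynomialRing d) := by
  refine isNoetherianRing_iff.mpr ⟨fun I ↦ ?_⟩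
  obtain ⟨N, hN⟩ := monotone_stabilizes_iff_noetherian.mpr ‹IsNoetherianRing A›
    ⟨leadingIdeal I, leadingIdeal_mono I⟩
  obtain ⟨s, hs⟩ : (restrictIdeal I ⊓ degreeLT d (N + 1)).FG := by
    have h := (IsNoetherian.noetherian
      ((restrictIdeal I).comap (degreeLT d (N + 1)).subtype)).map (degreeLT d (N + 1)).subtype
    rwa [Submodule.map_comap_subtype, inf_comm] at h
  have hsI : (s : Set (SkewPolynomialRing d)) ⊆ I := fun p hp ↦
    (hs ▸ Submodule.subset_span hp : p ∈ restrictIdeal I ⊓ degreeLT d (N + 1)).1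
  refine ⟨s, le_antisymm (Submodule.span_le.mpr hsI) ?_⟩
  set J : Ideal (SkewPolynomialRing d) := Submodule.span _ (s : Set (SkewPolynomialRing d))
  have hlow : restrictIdeal I ⊓ degreeLT d (N + 1) ≤ restrictIdeal J :=
    hs ▸ Submodule.span_le.mpr fun p hp ↦ Submodule.subset_span hp
  have key : ∀ n, ∀ p ∈ I, p ∈ degreeLT d n → p ∈ J := by
    intro n
    induction n with
    | zero =>
      intro p _ hp
      rw [eq_zero_of_mem_degreeLT_zero hp]
      exact J.zero_mem
    | succ n ih =>
      intro p hpI hp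
      rcases le_or_gt n N with hn | hn
      · exact hlow ⟨hpI, degreeLT_mono (by lia) hp⟩
      -- The element q of degree at most N has the same top coefficient as p, so subtracting ξ ^ (n
      -- - N) q lowers the degree of p.
      · obtain ⟨q, ⟨hqI, hq⟩, hqp⟩ : coeff d n p ∈ leadingIdeal I N := by
          have h : leadingIdeal I N = leadingIdeal I n := hN n hn.le
          rw [h]
          exact ⟨p, ⟨hpI, hp⟩, rfl⟩
        have hqJ : q ∈ J := hlow ⟨hqI, hq⟩
        have hmul : xi d ^ (n - N) * q = (xiMul d ^ (n - N)) q := by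
          rw [← one_mul (xi d ^ (n - N)), ← map_one (C d), C_mul_xi_pow, monomial_mul, one_smul]
        have hc := coeff_xiMul_pow hq (n - N)
        rw [add_tsub_cancel_of_le hn.le, hqp] at hc
        have hr : p - xi d ^ (n - N) * q ∈ degreeLT d n := by
          refine mem_degreeLT_of_coeff_eq_zero (sub_mem hp ?_) ?_
          · rw [hmul]
            exact degreeLT_mono (by lia) (xiMul_pow_mem_degreeLT hq (n - N))
          · rw [hmul, map_sub, hc, sub_self]
        have := ih _ (I.sub_mem hpI (Ideal.mul_mem_left I _ hqI)) hr
        simpa using J.add_mem this (J.mul_mem_left (xi d ^ (n - N)) hqJ)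
  intro p hp
  obtain ⟨n, hn⟩ := exists_mem_degreeLT p
  exact key n p hp hn

/-- The opposite of `A[ξ; 1, d]` is a quotient of `A[ξ; 1, -d]`. -/
theorem isNoetherianRing_mulOpposite [IsNoetherianRing A] :
    IsNoetherianRing (SkewPolynomialRing d)ᵐᵒᵖ := by
  have hcomm (a b : A) : Commute (C d a) (C d b) := (Commute.all a b).map (C d)
  let f : A →ₐ[k] (SkewPolynomialRing d)ᵐᵒᵖ := (C d).toOpposite hcomm
  have hf (a : A) : f a = MulOpposite.op (C d a) := rfl
  -- Reversing the product turns ξ a = a ξ + d a into a relation of the same shape with -d.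
  have hx (a : A) : MulOpposite.op (xi d) * f a =
      f a * MulOpposite.op (xi d) + f ((-d : Derivation k A A) a) := by
    rw [Derivation.neg_apply, hf, hf, ← MulOpposite.op_mul, ← MulOpposite.op_mul, xi_mul_C, map_neg,
      MulOpposite.op_add, MulOpposite.op_neg, add_neg_cancel_right]
  have := isNoetherianRing (d := -d)
  refine isNoetherianRing_of_surjective _ _ (lift f hx).toRingHom fun p ↦ ?_
  induction p using MulOpposite.rec' with | _ p
  induction p using induction_on with
  | h0 => exact ⟨0, map_zero _⟩
  | hadd p q hp hq =>
    obtain ⟨p', hp⟩ := hp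
    obtain ⟨q', hq⟩ := hq
    exact ⟨p' + q', by rw [map_add, hp, hq, MulOpposite.op_add]⟩
  | hm i a =>
    -- The factors are written in the opposite order because `MulOpposite.op` reverses products.
    refine ⟨xi _ ^ i * C _ a, ?_⟩
    change lift f hx _ = _
    rw [map_mul, map_pow, lift_xi, lift_C, hf, ← MulOpposite.op_pow, ← MulOpposite.op_mul,
      C_mul_xi_pow]

/-! ### The grading -/

section Grading

variable {𝒜 : ℤ → Submodule k A} {m : ℤ}

theorem monomial_mem_weightPiece {n : ℤ} {i : ℕ} {a : A} (ha : a ∈ 𝒜 (n - i * m)) :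
    monomial d i a ∈ weightPiece d 𝒜 m n := by
  intro j
  rw [coeff_monomial]
  split_ifs with h
  · exact h ▸ ha
  · exact zero_mem _

/-- Both terms of `xiMul` raise the weight by m: the shift because ξ has weight m, the derivation by
`hd`. -/
theorem xiMul_mem_weightPiece (hd : ∀ n, ∀ a ∈ 𝒜 n, d a ∈ 𝒜 (n + m)) {n : ℤ}
    {p : SkewPolynomialRing d} (hp : p ∈ weightPiece d 𝒜 m n) :
    xiMul d p ∈ weightPiece d 𝒜 m (n + m) := by
  intro i
  have hdi : d (coeff d i p) ∈ 𝒜 (n + m - i * m) := by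
    simpa only [sub_add_eq_add_sub] using hd _ _ (hp i)
  cases i with
  | zero => rwa [coeff_xiMul_zero]
  | succ i =>
    rw [coeff_xiMul_succ]
    refine add_mem ?_ hdi
    convert hp i using 2
    push_cast
    ring

variable (d 𝒜) in
/-- The monomials `a ξ ^ i` with `a` of weight `j`, as elements of weight `j + i * m`. -/
noncomputable def weightMonomial (m j : ℤ) (i : ℕ) :
    𝒜 j →ₗ[k] weightPiece d 𝒜 m (j + i * m) :=
  LinearMap.codRestrict _ ((Finsupp.lsingle i : A →ₗ[k] (ℕ →₀ A)) ∘ₗ (𝒜 j).subtype)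
    fun a ↦ monomial_mem_weightPiece (by rw [add_sub_cancel_right]; exact a.2)

variable [GradedAlgebra 𝒜]

theorem smul_mem_weightPiece {j n : ℤ} {a : A} (ha : a ∈ 𝒜 j) {p : SkewPolynomialRing d}
    (hp : p ∈ weightPiece d 𝒜 m n) : a • p ∈ weightPiece d 𝒜 m (j + n) := by
  intro i
  rw [coeff_smul, add_sub_assoc]
  exact SetLike.mul_mem_graded ha (hp i)

theorem weightPiece_gradedMonoid (hd : ∀ n, ∀ a ∈ 𝒜 n, d a ∈ 𝒜 (n + m)) :
    SetLike.GradedMonoid (weightPiece d 𝒜 m) where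
  one_mem := monomial_mem_weightPiece (by simpa using SetLike.one_mem_graded 𝒜)
  mul_mem j n p q hp hq := by
    obtain ⟨N, hN⟩ := exists_mem_degreeLT p
    rw [mul_eq_sum p q hN]
    refine sum_mem fun i _ ↦ ?_
    have h : ∀ i : ℕ, (xiMul d ^ i) q ∈ weightPiece d 𝒜 m (n + i * m) := by
      intro i
      induction i with
      | zero => simpa using hq
      | succ i ih =>
        rw [pow_succ', Module.End.mul_apply]
        convert xiMul_mem_weightPiece hd ih using 2
        push_cast
        ring
    convert smul_mem_weightPiece (hp i) (h i) using 2
    ring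

variable (d 𝒜 m) in
/-- The decomposition of `a ξ ^ i` by weights. -/
noncomputable def weightDecomposeMonomial (i : ℕ) : A →ₗ[k] ⨁ n, weightPiece d 𝒜 m n :=
  DirectSum.toModule k ℤ (⨁ n, weightPiece d 𝒜 m n)
      (fun j ↦ DirectSum.lof k ℤ (fun n ↦ weightPiece d 𝒜 m n) (j + i * m) ∘ₗ
        weightMonomial d 𝒜 m j i) ∘ₗ
    (DirectSum.decomposeLinearEquiv 𝒜).toLinearMap

theorem weightDecomposeMonomial_coe (i : ℕ) {j : ℤ} (a : 𝒜 j) :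
    weightDecomposeMonomial d 𝒜 m i (a : A) =
      DirectSum.of (fun n ↦ weightPiece d 𝒜 m n) (j + i * m) (weightMonomial d 𝒜 m j i a) := by
  rw [weightDecomposeMonomial, LinearMap.comp_apply, LinearEquiv.coe_coe,
    DirectSum.decomposeLinearEquiv_apply, DirectSum.decompose_coe,
    ← DirectSum.lof_eq_of k, DirectSum.toModule_lof, LinearMap.comp_apply, DirectSum.lof_eq_of]

variable (d 𝒜 m) in
/-- The decomposition of a skew polynomial by weights. -/
noncomputable def weightDecompose :
    SkewPolynomialRing d →ₗ[k] ⨁ n, weightPiece d 𝒜 m n :=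
  (Finsupp.lsum k (weightDecomposeMonomial d 𝒜 m) : (ℕ →₀ A) →ₗ[k] _)

theorem weightDecompose_monomial (i : ℕ) {j : ℤ} (a : 𝒜 j) :
    weightDecompose d 𝒜 m (monomial d i (a : A)) =
      DirectSum.of (fun n ↦ weightPiece d 𝒜 m n) (j + i * m) (weightMonomial d 𝒜 m j i a) :=
  (Finsupp.lsum_single k (weightDecomposeMonomial d 𝒜 m) i (a : A)).trans
    (weightDecomposeMonomial_coe i a)

/-- Moves the result to an index that equals j + i m only propositionally. -/
theorem weightDecompose_monomial_of_eq (i : ℕ) {j n : ℤ} (h : j + i * m = n) (a : 𝒜 j)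
    (ha : monomial d i (a : A) ∈ weightPiece d 𝒜 m n) :
    weightDecompose d 𝒜 m (monomial d i (a : A)) =
      DirectSum.of (fun n ↦ weightPiece d 𝒜 m n) n ⟨_, ha⟩ := by
  subst h
  exact weightDecompose_monomial i a

variable (d) in
/-- The skew polynomial ring of a derivation of weight `m` is graded. -/
noncomputable abbrev weightGradedAlgebra (hd : ∀ n, ∀ a ∈ 𝒜 n, d a ∈ 𝒜 (n + m)) :
    GradedAlgebra (weightPiece d 𝒜 m) :=
  { weightPiece_gradedMonoid hd with
    decompose' := weightDecompose d 𝒜 m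
    left_inv := fun p ↦ by
      induction p using induction_on with
      | h0 => simp
      | hadd p q hp hq => rw [map_add, map_add, hp, hq]
      | hm i a =>
        induction a using DirectSum.Decomposition.inductionOn 𝒜 with
        | zero => simp [monomial_zero]
        | homogeneous a => rw [weightDecompose_monomial, DirectSum.coeAddMonoidHom_of]; rfl
        | add a b ha hb => rw [monomial_add, map_add, map_add, ha, hb]
    right_inv := fun x ↦ by
      induction x using DirectSum.induction_on with
      | zero => simp
      | add x y hx hy => rw [map_add, map_add, hx, hy]
      | of n p =>
        rw [DirectSum.coeAddMonoidHom_of]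
        obtain ⟨p, hp⟩ := p
        have hmem (i : ℕ) : monomial d i (coeff d i p) ∈ weightPiece d 𝒜 m n :=
          monomial_mem_weightPiece (hp i)
        obtain ⟨N, hN⟩ := exists_mem_degreeLT p
        have hsum := eq_sum_monomial hN
        -- Every monomial of an element of weight n has weight n itself, so the decomposition can be
        -- computed monomial by monomial inside one piece.
        have hsum' : (⟨p, hp⟩ : weightPiece d 𝒜 m n) = ∑ i ∈ Finset.range N, ⟨_, hmem i⟩ :=
          Subtype.ext (by simpa using hsum)
        change weightDecompose d 𝒜 m p = _
        rw [hsum', map_sum]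
        conv_lhs => rw [hsum, map_sum]
        exact Finset.sum_congr rfl fun i _ ↦
          weightDecompose_monomial_of_eq i (by ring) ⟨_, hp i⟩ (hmem i) }

end Grading

end SkewPolynomialRing

/-- A left Noetherian domain is a left Ore domain. -/
theorem IsNoetherianRing.isLeftOreDomain {R : Type*} [Ring R] [IsDomain R] [IsNoetherianRing R] :
    IsLeftOreDomain R := by
  refine ⟨inferInstance, OreLocalization.nonempty_oreSet_iff_of_noZeroDivisors.mpr fun r s ↦ ?_⟩
  have hs : (s : R) ≠ 0 := nonZeroDivisors.coe_ne_zero s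
  -- The map (a, b) ↦ a r - b s from R² to R cannot be injective, because a nontrivial Noetherian
  -- ring satisfies the strong rank condition. A nonzero kernel vector is a common left multiple of
  -- r and s.
  let φ : (Fin 2 → R) →ₗ[R] (Fin 1 → R) := LinearMap.pi fun _ ↦
    LinearMap.toSpanSingleton R R r ∘ₗ LinearMap.proj 0 -
      LinearMap.toSpanSingleton R R (s : R) ∘ₗ LinearMap.proj 1
  have hφ : ¬ Function.Injective φ := fun h ↦ by
    have := le_of_fin_injective R φ h
    lia
  obtain ⟨v, hv, hv0⟩ : ∃ v, φ v = 0 ∧ v ≠ 0 := by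
    rw [injective_iff_map_eq_zero] at hφ
    push Not at hφ
    exact hφ
  have hrs : v 0 * r = v 1 * s := by
    simpa [φ, sub_eq_zero] using congrFun hv 0
  -- If v 0 = 0 then v 1 * s = 0 with s ≠ 0, so v vanishes altogether.
  have h0 : v 0 ≠ 0 := fun h0 ↦ by
    rw [h0, zero_mul, eq_comm, mul_eq_zero, or_iff_left hs] at hrs
    refine hv0 (funext fun i ↦ ?_)
    fin_cases i <;> assumption
  exact ⟨v 1, ⟨v 0, mem_nonZeroDivisors_of_ne_zero h0⟩, hrs⟩

namespace MLDO

open UpperHalfPlane ModularForm EisensteinSeries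

/-! ### The algebra of modular forms is a polynomial ring -/

/-- The point i is fixed by S, so modularity in weight 6 gives E₆(i) = i⁻⁶ E₆(i) = -E₆(i). -/
theorem E₆_apply_I : E₆ UpperHalfPlane.I = 0 := by
  have h : (E₆ : ℍ → ℂ) ∣[(6 : ℤ)] ModularGroup.S = E₆ := E₆.slash_action_eq' _ ⟨_, rfl⟩
  have h := congrFun h UpperHalfPlane.I
  have hS : ModularGroup.S • UpperHalfPlane.I = UpperHalfPlane.I := by
    ext
    rw [UpperHalfPlane.modular_S_smul]
    simp
  rw [ModularForm.SL_slash_apply, hS] at h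
  have h6 : (Complex.I : ℂ) ^ (-6 : ℤ) = -1 := by
    rw [zpow_neg, show (6 : ℤ) = ((6 : ℕ) : ℤ) from rfl, zpow_natCast,
      show Complex.I ^ 6 = (Complex.I ^ 2) ^ 3 by ring]
    norm_num
  rw [ModularGroup.denom_S, UpperHalfPlane.coe_I, h6, mul_neg_one] at h
  exact self_eq_neg.mp h.symm

theorem E₄_apply_I_ne_zero : E₄ UpperHalfPlane.I ≠ 0 := fun h ↦
  discriminant_ne_zero UpperHalfPlane.I (by
    rw [discriminant_eq_E₄_cube_sub_E₆_sq, h, E₆_apply_I]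
    norm_num)

/-- The linear map `f ↦ f(z) t ^ k` on modular forms of weight `k`. -/
noncomputable def evalTwistForm (z : ℍ) (t : ℂ) (k : ℤ) : ModularForm 𝒮ℒ k →ₗ[ℂ] ℂ where
  toFun f := f z * t ^ k
  map_add' f g := by simp [add_mul]
  map_smul' c f := by simp [mul_assoc]

/-- The character `f ↦ f(z) t ^ k` of the algebra of modular forms, for `f` of weight `k`. -/
noncomputable def evalTwist (z : ℍ) {t : ℂ} (ht : t ≠ 0) : ModularFormAlgebra →ₐ[ℂ] ℂ :=
  DirectSum.toAlgebra ℂ (fun k ↦ ModularForm 𝒮ℒ k) (evalTwistForm z t)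
    (by
      change (1 : ℂ) * t ^ (0 : ℤ) = 1
      simp)
    (fun {i j} f g ↦ by
      change f z * g z * t ^ (i + j) = f z * t ^ i * (g z * t ^ j)
      rw [zpow_add₀ ht]
      ring)

theorem evalTwist_ofForm (z : ℍ) {t : ℂ} (ht : t ≠ 0) {k : ℤ} (f : ModularForm 𝒮ℒ k) :
    evalTwist z ht (ofForm k f) = f z * t ^ k :=
  DirectSum.toModule_lof (φ := evalTwistForm z t) ℂ k f

theorem ofForm_mul_apply_add {k : ℤ} (f : ModularForm 𝒮ℒ k) (a : ModularFormAlgebra) (l : ℤ) :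
    (ofForm k f * a) (k + l) = f.mul (a l) := by
  induction a using DirectSum.induction_on with
  | zero => rw [mul_zero]; exact (DFunLike.coe_injective (mul_zero (f : ℍ → ℂ))).symm
  | add a b ha hb =>
    rw [mul_add, DirectSum.add_apply, ha, hb, DirectSum.add_apply]
    exact (DFunLike.coe_injective (mul_add (f : ℍ → ℂ) _ _)).symm
  | of j g =>
    change (ofForm k f * ofForm j g) (k + l) = _
    rw [ofForm_mul_ofForm]
    change DirectSum.of (fun k ↦ ModularForm 𝒮ℒ k) (k + j) (f.mul g) (k + l) = _
    rcases eq_or_ne l j with rfl | h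
    · rw [DirectSum.of_eq_same, DirectSum.of_eq_same]
    · rw [DirectSum.of_eq_of_ne _ _ _ (by simpa using h), DirectSum.of_eq_of_ne _ _ _ h]
      exact (DFunLike.coe_injective (mul_zero (f : ℍ → ℂ))).symm

/-- As E₆ is homogeneous, the product can be tested in each weight, where nonzero forms have nonzero
product. This does not use that ℳ is a domain, which is deduced later. -/
theorem eq_zero_of_formE₆_mul_eq_zero {a : ModularFormAlgebra} (h : formE₆ * a = 0) : a = 0 := by
  refine DFinsupp.ext fun k ↦ ?_
  by_contra hk
  refine ModularForm.mul_ne_zero ⟨1, one_mem_strictPeriods_SL, one_pos⟩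
    (EisensteinSeries.E_ne_zero _ ⟨3, rfl⟩ : E₆ ≠ 0) hk ?_
  rw [← ofForm_mul_apply_add]
  exact congrArg (fun a : ModularFormAlgebra ↦ a (6 + k)) h

/-- P(X, Y) and P(X, 0) agree modulo Y. -/
theorem X_one_dvd_sub (P : MvPolynomial (Fin 2) ℂ) :
    MvPolynomial.X 1 ∣ P - Polynomial.aeval (MvPolynomial.X 0 : MvPolynomial (Fin 2) ℂ)
      (MvPolynomial.aeval ![Polynomial.X, 0] P : Polynomial ℂ) := by
  induction P using MvPolynomial.induction_on with
  | C c => simp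
  | add p q hp hq =>
    simp only [map_add, add_sub_add_comm]
    exact dvd_add hp hq
  | mul_X p i hp =>
    fin_cases i
    · simp only [map_mul, MvPolynomial.aeval_X, Fin.zero_eta, Matrix.cons_val_zero,
        Polynomial.aeval_X, ← sub_mul]
      exact hp.mul_right _
    · simp

/-- The characters `evalTwist` at z = i send E₆ to 0 and E₄ to t⁴ E₄(i), which takes every nonzero
value w as t varies. Hence P(X, 0) has infinitely many roots. -/
theorem X_one_dvd_of_aeval_eq_zero {P : MvPolynomial (Fin 2) ℂ}
    (hP : MvPolynomial.aeval ![formE₄, formE₆] P = 0) : MvPolynomial.X 1 ∣ P := by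
  suffices h : (MvPolynomial.aeval ![Polynomial.X, 0] P : Polynomial ℂ) = 0 by
    simpa [h] using X_one_dvd_sub P
  refine Polynomial.eq_zero_of_infinite_isRoot _ ((Set.finite_singleton (0 : ℂ)).infinite_compl.mono
    fun w hw ↦ ?_)
  obtain ⟨t, ht⟩ := IsAlgClosed.exists_pow_nat_eq (w / E₄ UpperHalfPlane.I) (n := 4) (by norm_num)
  have ht0 : t ≠ 0 := by
    rintro rfl
    rw [zero_pow (by norm_num), eq_comm, div_eq_zero_iff] at ht
    exact ht.elim hw E₄_apply_I_ne_zero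
  have h4 : evalTwist UpperHalfPlane.I ht0 formE₄ = w := by
    have ht' : t ^ (4 : ℤ) = w / E₄ UpperHalfPlane.I := ht
    rw [formE₄, evalTwist_ofForm, ht', mul_div_cancel₀ _ E₄_apply_I_ne_zero]
  have h6 : evalTwist UpperHalfPlane.I ht0 formE₆ = 0 := by
    rw [formE₆, evalTwist_ofForm, E₆_apply_I, zero_mul]
  have hcomp : (Polynomial.aeval w).comp (MvPolynomial.aeval ![Polynomial.X, 0]) =
      (evalTwist UpperHalfPlane.I ht0).comp (MvPolynomial.aeval ![formE₄, formE₆]) := by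
    ext i
    fin_cases i
    · simp [h4]
    · simp [h6]
  have := DFunLike.congr_fun hcomp P
  simpa [hP, Polynomial.IsRoot] using this

/-- A nonzero relation would be Y Q, and cancelling E₆ would make Q a relation of smaller total
degree. -/
theorem aeval_formE₄_formE₆_injective :
    Function.Injective (MvPolynomial.aeval ![formE₄, formE₆] :
      MvPolynomial (Fin 2) ℂ →ₐ[ℂ] ModularFormAlgebra) := by
  rw [injective_iff_map_eq_zero]
  intro P hP
  induction h : P.totalDegree using Nat.strong_induction_on generalizing P with | _ n ih
  obtain ⟨Q, rfl⟩ := X_one_dvd_of_aeval_eq_zero hP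
  rcases eq_or_ne Q 0 with rfl | hQ
  · rw [mul_zero]
  · rw [MvPolynomial.totalDegree_mul_of_isDomain (MvPolynomial.X_ne_zero _) hQ,
      MvPolynomial.totalDegree_X] at h
    rw [map_mul, MvPolynomial.aeval_X] at hP
    exact absurd (ih _ (by lia) Q (eq_zero_of_formE₆_mul_eq_zero hP) rfl) hQ

theorem ofForm_pow {k : ℤ} (f : ModularForm 𝒮ℒ k) (n : ℕ) :
    ofForm k f ^ n = ofForm (n * k) (f.pow n) := by
  have := ModularForm.directSum_of_pow f n
  exact this

theorem ofForm_discriminant_mem_adjoin :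
    ofForm 12 (CuspForm.discriminant : ModularForm 𝒮ℒ 12) ∈
      Algebra.adjoin ℂ {formE₄, formE₆} := by
  have h4 : formE₄ ∈ Algebra.adjoin ℂ {formE₄, formE₆} := Algebra.subset_adjoin (by simp)
  have h6 : formE₆ ∈ Algebra.adjoin ℂ {formE₄, formE₆} := Algebra.subset_adjoin (by simp)
  change DirectSum.of (ModularForm 𝒮ℒ) 12 CuspForm.discriminant ∈ _
  rw [discriminant_eq_E₄_cube_sub_E₆_sq_graded]
  exact Subalgebra.smul_mem _ (sub_mem (pow_mem h4 3) (pow_mem h6 2)) _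

/-- For even `k ≥ 4` there is a monomial in `E₄` and `E₆` of weight `k`. -/
theorem exists_ofForm_eq_monomial {k : ℤ} (hk : 4 ≤ k) (hk2 : Even k) :
    ∃ (g : ModularForm 𝒮ℒ k) (a b : ℕ), (qExpansion 1 g).coeff 0 = 1 ∧
      ofForm k g = formE₄ ^ a * formE₆ ^ b := by
  -- Weights divisible by 4 use E₄ alone; otherwise k = 4 i + 2 = 4 (i - 1) + 6, with i ≥ 1 because
  -- k ≥ 4.
  obtain ⟨a, b, rfl⟩ : ∃ a b : ℕ, k = a * 4 + b * 6 := by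
    obtain ⟨j, rfl⟩ := hk2
    rcases Int.even_or_odd j with ⟨i, rfl⟩ | ⟨i, rfl⟩
    · exact ⟨i.toNat, 0, by lia⟩
    · exact ⟨(i - 1).toNat, 1, by lia⟩
  refine ⟨(E₄.pow a).mul (E₆.pow b), a, b, ?_, ?_⟩
  · rw [ModularForm.qExpansion_mul one_pos one_mem_strictPeriods_SL,
      ModularForm.qExpansion_pow one_pos one_mem_strictPeriods_SL,
      ModularForm.qExpansion_pow one_pos one_mem_strictPeriods_SL,
      PowerSeries.coeff_zero_eq_constantCoeff_apply, map_mul, map_pow, map_pow,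
      ← PowerSeries.coeff_zero_eq_constantCoeff_apply,
      ← PowerSeries.coeff_zero_eq_constantCoeff_apply,
      EisensteinSeries.E_qExpansion_coeff_zero _ ⟨2, rfl⟩,
      EisensteinSeries.E_qExpansion_coeff_zero _ ⟨3, rfl⟩, one_pow, one_pow, one_mul]
  · rw [formE₄, formE₆, ofForm_pow, ofForm_pow, ofForm_mul_ofForm]

/-- For even k ≥ 4, subtracting a multiple of a monomial of weight k with constant term 1 leaves a
cusp form, which is the discriminant times a form of weight k - 12. -/
theorem ofForm_mem_adjoin (k : ℤ) (f : ModularForm 𝒮ℒ k) :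
    ofForm k f ∈ Algebra.adjoin ℂ {formE₄, formE₆} := by
  have h4 : formE₄ ∈ Algebra.adjoin ℂ {formE₄, formE₆} := Algebra.subset_adjoin (by simp)
  have h6 : formE₆ ∈ Algebra.adjoin ℂ {formE₄, formE₆} := Algebra.subset_adjoin (by simp)
  induction h : k.toNat using Nat.strong_induction_on generalizing k with | _ n ih
  rcases lt_or_ge k 0 with hk | hk
  · rw [rank_zero_iff_forall_zero.mp (levelOne_neg_weight_rank_zero hk) f, map_zero]
    exact zero_mem _
  rcases Int.even_or_odd k with hk2 | hk2
  swap
  · rw [levelOne_odd_weight_eq_zero hk2 f, map_zero]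
    exact zero_mem _
  obtain rfl | rfl | hk4 : k = 0 ∨ k = 2 ∨ 4 ≤ k := by grind
  · obtain ⟨c, hc⟩ := ModularFormClass.levelOne_weight_zero_const f
    have : ofForm 0 f = algebraMap ℂ ModularFormAlgebra c :=
      congrArg (ofForm 0) (DFunLike.coe_injective hc : f = ModularForm.const c)
    rw [this]
    exact Subalgebra.algebraMap_mem _ c
  · rw [rank_zero_iff_forall_zero.mp levelOne_weight_two_rank_zero f, map_zero]
    exact zero_mem _
  · obtain ⟨g, a, b, hg, hgab⟩ := exists_ofForm_eq_monomial hk4 hk2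
    obtain ⟨F, hF⟩ := sub_smul_isCuspForm f g hg
    set c := (qExpansion 1 f).coeff 0
    have hmul : ofForm 12 (CuspForm.discriminant : ModularForm 𝒮ℒ 12) *
        ofForm (k - 12) (CuspForm.discriminantEquiv F) = ofForm k (f - c • g) := by
      rw [ofForm_mul_ofForm]
      refine ofForm_eq_ofForm (by ring) _ _ ?_
      rw [← hF]
      exact discriminant_mul_discriminantEquiv F
    rw [← sub_add_cancel f (c • g), map_add, ← hmul, map_smul, hgab]
    exact add_mem (mul_mem ofForm_discriminant_mem_adjoin (ih _ (by lia) _ _ rfl))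
      (Subalgebra.smul_mem _ (mul_mem (pow_mem h4 a) (pow_mem h6 b)) c)

theorem adjoin_formE₄_formE₆ : Algebra.adjoin ℂ {formE₄, formE₆} = ⊤ := by
  refine eq_top_iff.mpr fun a _ ↦ ?_
  induction a using DirectSum.induction_on with
  | zero => exact zero_mem _
  | add a b ha hb => exact add_mem (ha trivial) (hb trivial)
  | of k f => exact ofForm_mem_adjoin k f

theorem aeval_formE₄_formE₆_bijective :
    Function.Bijective (MvPolynomial.aeval ![formE₄, formE₆] :
      MvPolynomial (Fin 2) ℂ →ₐ[ℂ] ModularFormAlgebra) := by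
  refine ⟨aeval_formE₄_formE₆_injective, AlgHom.range_eq_top _ |>.mp ?_⟩
  rw [← Algebra.adjoin_range_eq_range_aeval, Matrix.range_cons, Matrix.range_cons,
    Matrix.range_empty, Set.union_empty]
  exact adjoin_formE₄_formE₆

instance : IsNoetherianRing ModularFormAlgebra :=
  isNoetherianRing_of_surjective _ _ _ aeval_formE₄_formE₆_bijective.2

instance : IsDomain ModularFormAlgebra :=
  (AlgEquiv.ofBijective _ aeval_formE₄_formE₆_bijective).symm.toMulEquiv.isDomain _

/-! ### The grading of the algebra of modular forms -/

theorem serreDerivation_ofForm (k : ℤ) (f : ModularForm 𝒮ℒ k) :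
    serreDerivation (ofForm k f) = ofForm (k + 2) (serreForm k f) :=
  serreLinear_ofForm k f

theorem serreDerivation_mem_formWeight (k : ℤ) :
    ∀ a ∈ formWeight k, serreDerivation a ∈ formWeight (k + 2) := by
  rintro _ ⟨f, rfl⟩
  exact ⟨_, (serreDerivation_ofForm k f).symm⟩

instance : SetLike.GradedMonoid formWeight where
  one_mem := ⟨1, rfl⟩
  mul_mem := by
    rintro k l _ _ ⟨f, rfl⟩ ⟨g, rfl⟩
    exact ⟨_, (ofForm_mul_ofForm f g).symm⟩

/-- A modular form of weight `k`, as an element of the homogeneous part of weight `k`. -/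
noncomputable def ofFormWeight (k : ℤ) : ModularForm 𝒮ℒ k →ₗ[ℂ] formWeight k :=
  (ofForm k).rangeRestrict

noncomputable instance : DirectSum.Decomposition formWeight :=
  DirectSum.Decomposition.ofLinearMap formWeight
    (DirectSum.toModule ℂ ℤ (⨁ k, formWeight k) fun k ↦
      DirectSum.lof ℂ ℤ (fun k ↦ formWeight k) k ∘ₗ ofFormWeight k)
    (DirectSum.linearMap_ext _ fun k ↦ LinearMap.ext fun f ↦ by
      rw [LinearMap.comp_apply, LinearMap.comp_apply, DirectSum.toModule_lof,
        LinearMap.comp_apply, DirectSum.coeLinearMap_lof]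
      rfl)
    (DirectSum.linearMap_ext _ fun k ↦ LinearMap.ext fun ⟨_, f, hf⟩ ↦ by
      subst hf
      rw [LinearMap.comp_apply, LinearMap.comp_apply, DirectSum.coeLinearMap_lof]
      exact DirectSum.toModule_lof ℂ k f)

noncomputable instance : GradedAlgebra formWeight where

theorem nonempty_gradedAlgebra_weightPiece :
    Nonempty (GradedAlgebra (SkewPolynomialRing.weightPiece serreDerivation formWeight 2)) :=
  ⟨SkewPolynomialRing.weightGradedAlgebra serreDerivation serreDerivation_mem_formWeight⟩

end MLDO

namespace SkewPolynomialRing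

/-! ### Functoriality -/

section Map

variable {k A B : Type*} [CommRing k] [CommRing A] [Algebra k A] [CommRing B] [Algebra k B]
  {d : Derivation k A A} {d' : Derivation k B B} (f : A →ₐ[k] B)
  (hf : ∀ a, f (d a) = d' (f a))

/-- The map of skew polynomial rings induced by a map of differential algebras. -/
noncomputable def map : SkewPolynomialRing d →ₐ[k] SkewPolynomialRing d' :=
  lift ((C d').comp f) (x := xi d') fun a ↦ by
    rw [AlgHom.comp_apply, AlgHom.comp_apply, xi_mul_C, hf]

theorem map_monomial (i : ℕ) (a : A) : map f hf (monomial d i a) = monomial d' i (f a) :=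
  (lift_monomial _ _ i a).trans (C_mul_xi_pow d' (f a) i)

theorem coeff_map (i : ℕ) (p : SkewPolynomialRing d) :
    coeff d' i (map f hf p) = f (coeff d i p) := by
  induction p using induction_on with
  | h0 => simp
  | hadd p q hp hq => simp only [map_add, hp, hq]
  | hm j a =>
    rw [map_monomial, coeff_monomial, coeff_monomial]
    split_ifs <;> simp

theorem map_injective (hinj : Function.Injective f) : Function.Injective (map f hf) :=
  fun p q h ↦ ext fun i ↦ hinj (by rw [← coeff_map f hf, ← coeff_map f hf, h])

end Map

/-! ### The action on the coefficient algebra -/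

section Action

variable {k B : Type*} [Field k] [CommRing B] [Algebra k B] (d : Derivation k B B)

theorem lmul_apply (a b : B) : Algebra.lmul k B a b = a * b := rfl

/-- The action of `B[ξ; 1, d]` on `B` by differential operators. -/
noncomputable def action : SkewPolynomialRing d →ₐ[k] Module.End k B :=
  lift (Algebra.lmul k B) (x := (d : B →ₗ[k] B)) fun a ↦ LinearMap.ext fun b ↦ by
    simp only [Module.End.mul_apply, LinearMap.add_apply, lmul_apply,
      Derivation.coeFn_coe, Derivation.leibniz, smul_eq_mul]
    ring

theorem action_monomial (i : ℕ) (a : B) :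
    action d (monomial d i a) = Algebra.lmul k B a * (d : B →ₗ[k] B) ^ i :=
  lift_monomial _ _ i a

variable {d}

theorem coeff_xiMul_pow_succ_C (m : ℕ) (h : B) :
    coeff d m ((xiMul d ^ (m + 1)) (C d h)) = (m + 1) • d h := by
  have hC : C d h ∈ degreeLT d (0 + 1) := fun i hi ↦ by rw [coeff_C, if_neg (by lia)]
  induction m with
  | zero => rw [zero_add, pow_one, coeff_xiMul_zero, coeff_C, if_pos rfl, one_smul]
  | succ m ih =>
    have hm := coeff_xiMul_pow hC (m + 1)
    rw [zero_add, coeff_C, if_pos rfl] at hm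
    rw [pow_succ', Module.End.mul_apply, coeff_xiMul_succ, ih, hm, succ_nsmul _ (m + 1)]

theorem mul_C_sub_C_mul_mem_degreeLT {n : ℕ} {p : SkewPolynomialRing d}
    (hp : p ∈ degreeLT d (n + 1)) (h : B) : p * C d h - C d h * p ∈ degreeLT d n := by
  have hC : C d h ∈ degreeLT d (0 + 1) := fun i hi ↦ by rw [coeff_C, if_neg (by lia)]
  refine mem_degreeLT_of_coeff_eq_zero (sub_mem ?_ ?_) ?_
  · rw [mul_eq_sum p _ hp]
    refine sum_mem fun i hi ↦ Submodule.smul_mem _ _ ?_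
    rw [Finset.mem_range] at hi
    exact degreeLT_mono (by lia) (xiMul_pow_mem_degreeLT hC i)
  · rw [C_mul]
    exact Submodule.smul_mem _ _ hp
  · have := coeff_mul hp hC
    rw [add_zero, coeff_C, if_pos rfl] at this
    rw [map_sub, this, C_mul, coeff_smul, mul_comm, sub_self]

theorem coeff_mul_C_sub_C_mul {m : ℕ} {p : SkewPolynomialRing d}
    (hp : p ∈ degreeLT d (m + 2)) (h : B) :
    coeff d m (p * C d h - C d h * p) = (m + 1) • (coeff d (m + 1) p * d h) := by
  have hC : C d h ∈ degreeLT d (0 + 1) := fun i hi ↦ by rw [coeff_C, if_neg (by lia)]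
  have hm := coeff_xiMul_pow hC m
  rw [zero_add, coeff_C, if_pos rfl] at hm
  rw [map_sub, mul_eq_sum p _ hp, map_sum, Finset.sum_range_succ, Finset.sum_range_succ,
    Finset.sum_eq_zero, coeff_smul, coeff_smul, coeff_xiMul_pow_succ_C, hm, C_mul, coeff_smul,
    mul_smul_comm]
  · ring
  · intro i hi
    rw [Finset.mem_range] at hi
    rw [coeff_smul, xiMul_pow_mem_degreeLT hC i _ (by lia), mul_zero]

/-- If the derivation takes an invertible value, then the skew polynomial ring acts faithfully:
commutators with that element lower the degree by exactly one. -/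
theorem action_injective [CharZero k] {h : B} (hu : IsUnit (d h)) : Function.Injective (action d) := by
  rw [injective_iff_map_eq_zero]
  suffices ∀ n, ∀ p ∈ degreeLT d n, action d p = 0 → p = 0 by
    intro p hp
    obtain ⟨n, hn⟩ := exists_mem_degreeLT p
    exact this n p hn hp
  intro n
  induction n with
  | zero => exact fun p hp _ ↦ eq_zero_of_mem_degreeLT_zero hp
  | succ n ih =>
    intro p hp hp0
    refine ih p (mem_degreeLT_of_coeff_eq_zero hp ?_) hp0
    cases n with
    | zero =>
      have hpC : p = monomial d 0 (coeff d 0 p) := ext fun i ↦ by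
        rw [coeff_monomial]
        split_ifs with hi
        · rw [hi]
        · exact hp i (by lia)
      rw [hpC, action_monomial, pow_zero, mul_one] at hp0
      simpa using LinearMap.congr_fun hp0 1
    | succ m =>
      have hq := ih _ (mul_C_sub_C_mul_mem_degreeLT hp h) (by
        rw [map_sub, map_mul, map_mul, hp0, zero_mul, mul_zero, sub_zero])
      have hc := coeff_mul_C_sub_C_mul hp h
      rw [hq, map_zero, ← Nat.cast_smul_eq_nsmul k, eq_comm,
        smul_eq_zero_iff_right (Nat.cast_ne_zero.mpr m.succ_ne_zero)] at hc
      exact (hu.mul_left_eq_zero).mp hc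

end Action

end SkewPolynomialRing

namespace MLDO

open SkewPolynomialRing

/-! ### The algebra `H` and its derivation -/

theorem H.induction_on {P : H → Prop} (x : H) (zero : P 0) (add : ∀ x y, P x → P y → P (x + y))
    (of : ∀ n f, P (ofWeight n f)) : P x :=
  DirectSum.induction_on (motive := P) x zero of add

theorem one_eq_ofWeight : (1 : H) = ofWeight 0 1 := rfl

theorem ofWeight_congr {n m : ℝ} (h : n = m) (f : Hol) : ofWeight n f = ofWeight m f := by rw [h]

theorem end_ext {φ ψ : Module.End ℂ H} (h : ∀ n f, φ (ofWeight n f) = ψ (ofWeight n f)) :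
    φ = ψ := LinearMap.ext fun x ↦ by
  induction x using H.induction_on with
  | zero => simp
  | add x y hx hy => rw [map_add, map_add, hx, hy]
  | of n f => exact h n f

/-- The component of weight `n` of an element of `H`. -/
noncomputable def weightComponent (n : ℝ) : H →ₗ[ℂ] Hol :=
  (DirectSum.component ℂ ℝ (fun _ ↦ Hol) n : (⨁ _ : ℝ, Hol) →ₗ[ℂ] Hol)

theorem weightComponent_ofWeight (n : ℝ) (f : Hol) : weightComponent n (ofWeight n f) = f :=
  DirectSum.of_eq_same (β := fun _ : ℝ ↦ Hol) n f

theorem weightComponent_ofWeight_of_ne {n m : ℝ} (h : m ≠ n) (f : Hol) :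
    weightComponent n (ofWeight m f) = 0 :=
  DirectSum.of_eq_of_ne (β := fun _ : ℝ ↦ Hol) m n f h.symm

theorem delta_ofWeight (n : ℝ) (f : Hol) :
    delta (ofWeight n f) = ofWeight (n + 2) (serreHol n f) :=
  homogeneousEnd_ofWeight _ _ _ _

theorem serreHol_mul (n m : ℝ) (f g : Hol) :
    serreHol (n + m) (f * g) = f * serreHol m g + g * serreHol n f := by
  refine Subtype.ext ?_
  have h := Derivative.serreDerivative_mul n m f.1 g.1 f.2 g.2
  change Derivative.serreDerivative ((n + m : ℝ) : ℂ) (f.1 * g.1) =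
    f.1 * Derivative.serreDerivative m g.1 + g.1 * Derivative.serreDerivative n f.1
  rw [Complex.ofReal_add, h]
  ring

theorem delta_leibniz (x y : H) : delta (x * y) = x • delta y + y • delta x := by
  simp only [smul_eq_mul]
  induction x using H.induction_on with
  | zero => simp
  | add x x' hx hx' => simp only [add_mul, map_add, mul_add, hx, hx']; abel
  | of n f =>
    induction y using H.induction_on with
    | zero => simp
    | add y y' hy hy' => simp only [add_mul, map_add, mul_add, hy, hy']; abel
    | of m g =>
      rw [ofWeight_mul_ofWeight, delta_ofWeight, delta_ofWeight, delta_ofWeight,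
        ofWeight_mul_ofWeight, ofWeight_mul_ofWeight, serreHol_mul, map_add,
        ofWeight_congr (by ring : n + (m + 2) = n + m + 2),
        ofWeight_congr (by ring : m + (n + 2) = n + m + 2)]

/-- The derivation `δ` of `H`. -/
noncomputable def deltaDerivation : Derivation ℂ H H := Derivation.mk' delta delta_leibniz

theorem coe_deltaDerivation : (deltaDerivation : H →ₗ[ℂ] H) = delta := rfl

/-- The function `z` on the upper half plane. -/
def holCoordinate : Hol := ⟨fun z ↦ (z : ℂ), UpperHalfPlane.mdifferentiable_coe⟩

theorem serreHol_zero_holCoordinate :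
    serreHol 0 holCoordinate = algebraMap ℂ Hol (2 * Real.pi * Complex.I)⁻¹ := by
  refine Subtype.ext (funext fun z ↦ ?_)
  change (2 * Real.pi * Complex.I : ℂ)⁻¹ *
      deriv ((fun z : ℍ ↦ (z : ℂ)) ∘ UpperHalfPlane.ofComplex) z -
    ((0 : ℝ) : ℂ) * 12⁻¹ * EisensteinSeries.E2 z * z = (2 * Real.pi * Complex.I : ℂ)⁻¹
  rw [(UpperHalfPlane.eventuallyEq_coe_comp_ofComplex z.im_pos).deriv_eq]
  simp

theorem isUnit_deltaDerivation_holCoordinate :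
    IsUnit (deltaDerivation (ofWeight 0 holCoordinate)) := by
  change IsUnit (delta (ofWeight 0 holCoordinate))
  rw [delta_ofWeight, serreHol_zero_holCoordinate]
  refine IsUnit.of_mul_eq_one (ofWeight (-2) (algebraMap ℂ Hol (2 * Real.pi * Complex.I))) ?_
  rw [ofWeight_mul_ofWeight, ← map_mul, inv_mul_cancel₀ Complex.two_pi_I_ne_zero, map_one,
    one_eq_ofWeight]
  exact ofWeight_congr (by norm_num) 1

/-- The inclusion of the algebra of modular forms into `H`. -/
noncomputable def formToH : ModularFormAlgebra →ₐ[ℂ] H :=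
  DirectSum.toAlgebra ℂ (fun k ↦ ModularForm 𝒮ℒ k)
    (fun k ↦ ofWeight (k : ℝ) ∘ₗ
      { toFun := toHol
        map_add' := fun _ _ ↦ rfl
        map_smul' := fun _ _ ↦ rfl })
    (ofWeight_congr Int.cast_zero _)
    (fun {i j} f g ↦ (ofWeight_congr (Int.cast_add i j) _).trans
      (ofWeight_mul_ofWeight i j (toHol f) (toHol g)).symm)

theorem formToH_ofForm (k : ℤ) (f : ModularForm 𝒮ℒ k) :
    formToH (ofForm k f) = ofWeight k (toHol f) :=
  DirectSum.toModule_lof (M := fun k ↦ ModularForm 𝒮ℒ k) (φ := fun k : ℤ ↦ ofWeight (k : ℝ) ∘ₗ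
      { toFun := toHol
        map_add' := fun _ _ ↦ rfl
        map_smul' := fun _ _ ↦ rfl }) ℂ k f

theorem weightComponent_formToH (k : ℤ) (a : ModularFormAlgebra) :
    weightComponent k (formToH a) = toHol (a k) := by
  induction a using DirectSum.induction_on with
  | zero => rw [map_zero, map_zero]; rfl
  | add a b ha hb => rw [map_add, map_add, ha, hb]; rfl
  | of l f =>
    change weightComponent k (formToH (ofForm l f)) = toHol (ofForm l f k)
    rw [formToH_ofForm]
    rcases eq_or_ne l k with rfl | h
    · rw [weightComponent_ofWeight]
      exact congrArg toHol (DirectSum.of_eq_same (β := fun k ↦ ModularForm 𝒮ℒ k) l f).symm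
    · rw [weightComponent_ofWeight_of_ne (by exact_mod_cast h)]
      exact congrArg toHol (DirectSum.of_eq_of_ne (β := fun k ↦ ModularForm 𝒮ℒ k) l k f h.symm).symm

theorem formToH_injective : Function.Injective formToH := fun a b h ↦
  DFinsupp.ext fun k ↦ DFunLike.coe_injective (congrArg Subtype.val (by
    rw [← weightComponent_formToH, h, weightComponent_formToH] : toHol (a k) = toHol (b k)))

theorem formToH_serreDerivation (a : ModularFormAlgebra) :
    formToH (serreDerivation a) = deltaDerivation (formToH a) := by
  induction a using DirectSum.induction_on with
  | zero => simp
  | add a b ha hb => simp only [map_add, ha, hb]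
  | of k f =>
    change formToH (serreDerivation (ofForm k f)) = delta (formToH (ofForm k f))
    rw [serreDerivation_ofForm, formToH_ofForm, formToH_ofForm, delta_ofWeight,
      ofWeight_congr (by push_cast; ring : ((k + 2 : ℤ) : ℝ) = k + 2)]
    rfl

/-! ### The isomorphism -/

/-- The action of `ℳ[ξ; 1, δ]` on `H`. -/
noncomputable def mldoHom : SkewPolynomialRing serreDerivation →ₐ[ℂ] Module.End ℂ H :=
  (action deltaDerivation).comp (map formToH formToH_serreDerivation)

theorem mldoHom_injective : Function.Injective mldoHom :=
  (action_injective isUnit_deltaDerivation_holCoordinate).comp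
    (map_injective formToH formToH_serreDerivation formToH_injective)

theorem mldoHom_monomial (i : ℕ) (a : ModularFormAlgebra) :
    mldoHom (monomial _ i a) = Algebra.lmul ℂ H (formToH a) * delta ^ i := by
  rw [mldoHom, AlgHom.comp_apply, map_monomial, action_monomial, coe_deltaDerivation]

theorem mldoHom_C (a : ModularFormAlgebra) :
    mldoHom (C _ a) = Algebra.lmul ℂ H (formToH a) :=
  (mldoHom_monomial 0 a).trans (mul_one _)

theorem mldoHom_xi : mldoHom (xi _) = delta :=
  (mldoHom_monomial 1 1).trans (by rw [map_one, map_one, one_mul, pow_one])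

theorem mldoHom_C_formE₄ : mldoHom (C _ formE₄) = e₄ := by
  refine end_ext fun n f ↦ ?_
  rw [mldoHom_C, formE₄, formToH_ofForm, e₄, homogeneousEnd_ofWeight, lmul_apply,
    ofWeight_mul_ofWeight]
  exact ofWeight_congr (by push_cast; ring) _

theorem mldoHom_C_formE₆ : mldoHom (C _ formE₆) = e₆ := by
  refine end_ext fun n f ↦ ?_
  rw [mldoHom_C, formE₆, formToH_ofForm, e₆, homogeneousEnd_ofWeight, lmul_apply,
    ofWeight_mul_ofWeight]
  exact ofWeight_congr (by push_cast; ring) _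

theorem range_mldoHom : mldoHom.range = mldoAlgebra := by
  have htop : Algebra.adjoin ℂ {xi serreDerivation, C _ formE₄, C _ formE₆} = ⊤ := by
    refine eq_top_of_C_mem_of_xi_mem (fun a ↦ ?_) (Algebra.subset_adjoin (by simp))
    have ha : a ∈ Algebra.adjoin ℂ {formE₄, formE₆} := by rw [adjoin_formE₄_formE₆]; trivial
    have hCa : C serreDerivation a ∈
        (Algebra.adjoin ℂ {formE₄, formE₆}).map (C serreDerivation) := ⟨a, ha, rfl⟩
    rw [AlgHom.map_adjoin, Set.image_pair] at hCa
    exact Algebra.adjoin_mono (Set.subset_insert _ _) hCa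
  rw [← Algebra.map_top, ← htop, AlgHom.map_adjoin, Set.image_insert_eq, Set.image_pair,
    mldoHom_xi, mldoHom_C_formE₄, mldoHom_C_formE₆, mldoAlgebra]

/-- The isomorphism of `ℳ[ξ; 1, δ]` with the algebra of modular linear differential operators. -/
noncomputable def mldoEquiv : SkewPolynomialRing serreDerivation ≃ₐ[ℂ] mldoAlgebra :=
  (AlgEquiv.ofInjective mldoHom mldoHom_injective).trans (Subalgebra.equivOfEq _ _ range_mldoHom)

/-! ### Weights -/

theorem mul_mem_endWeight {i j : ℝ} {φ ψ : Module.End ℂ H} (hφ : φ ∈ endWeight i)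
    (hψ : ψ ∈ endWeight j) : φ * ψ ∈ endWeight (i + j) := fun n f ↦ by
  obtain ⟨g, hg⟩ := hψ n f
  obtain ⟨g', hg'⟩ := hφ (n + j) g
  exact ⟨g', by rw [Module.End.mul_apply, ← hg, ← hg']; exact ofWeight_congr (by ring) g'⟩

theorem one_mem_endWeight : (1 : Module.End ℂ H) ∈ endWeight 0 := fun n f ↦
  ⟨f, ofWeight_congr (add_zero n) f⟩

theorem delta_pow_mem_endWeight (i : ℕ) : delta ^ i ∈ endWeight (i * 2) := by
  induction i with
  | zero => simpa using one_mem_endWeight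
  | succ i ih =>
    rw [pow_succ]
    convert mul_mem_endWeight ih fun n f ↦ ⟨_, (delta_ofWeight n f).symm⟩ using 2
    push_cast
    ring

theorem lmul_formToH_mem_endWeight {k : ℤ} {a : ModularFormAlgebra} (ha : a ∈ formWeight k) :
    Algebra.lmul ℂ H (formToH a) ∈ endWeight k := fun n f ↦ by
  obtain ⟨g, rfl⟩ := ha
  refine ⟨toHol g * f, ?_⟩
  rw [formToH_ofForm, lmul_apply, ofWeight_mul_ofWeight]
  exact ofWeight_congr (add_comm _ _) _

theorem mldoHom_mem_endWeight {n : ℤ} {p : SkewPolynomialRing serreDerivation}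
    (hp : p ∈ weightPiece serreDerivation formWeight 2 n) : mldoHom p ∈ endWeight n := by
  obtain ⟨N, hN⟩ := exists_mem_degreeLT p
  rw [eq_sum_monomial hN, map_sum]
  refine sum_mem fun i _ ↦ ?_
  rw [mldoHom_monomial]
  convert mul_mem_endWeight (lmul_formToH_mem_endWeight (hp i)) (delta_pow_mem_endWeight i) using 2
  push_cast
  ring

/-- Operators of different weights are linearly independent. -/
theorem eq_zero_of_sum_mem_endWeight {s : Finset ℤ} {φ : ℤ → Module.End ℂ H}
    (hφ : ∀ m : ℤ, φ m ∈ endWeight m) {n : ℤ} (h : ∑ m ∈ s, φ m ∈ endWeight n) {m : ℤ} (hm : m ∈ s)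
    (hmn : m ≠ n) : φ m = 0 := by
  have hcomp {j l : ℤ} (hjl : j ≠ l) {ψ : Module.End ℂ H} (hψ : ψ ∈ endWeight j) (t : ℝ) (f : Hol) :
      weightComponent (t + l) (ψ (ofWeight t f)) = 0 := by
    obtain ⟨g, hg⟩ := hψ t f
    rw [← hg, weightComponent_ofWeight_of_ne]
    simpa using hjl
  refine end_ext fun t f ↦ ?_
  have h0 := hcomp hmn.symm h t f
  rw [LinearMap.sum_apply, map_sum, Finset.sum_eq_single_of_mem m hm fun j _ hj ↦
    hcomp hj (hφ j) t f] at h0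
  obtain ⟨g, hg⟩ := hφ m t f
  rw [← hg, weightComponent_ofWeight] at h0
  rw [← hg, h0, map_zero, LinearMap.zero_apply]

theorem mem_weightPiece_iff_mldoHom_mem_endWeight (n : ℤ)
    (p : SkewPolynomialRing serreDerivation) :
    p ∈ weightPiece serreDerivation formWeight 2 n ↔ mldoHom p ∈ endWeight n := by
  classical
  refine ⟨mldoHom_mem_endWeight, fun h ↦ ?_⟩
  obtain ⟨_⟩ := nonempty_gradedAlgebra_weightPiece
  let 𝒮 := weightPiece serreDerivation formWeight 2
  have hsum := DirectSum.sum_support_decompose 𝒮 p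
  rw [← hsum]
  rw [← hsum, map_sum] at h
  refine sum_mem fun m hm ↦ ?_
  rcases eq_or_ne m n with rfl | hmn
  · exact SetLike.coe_mem _
  · have h0 := eq_zero_of_sum_mem_endWeight
      (φ := fun m ↦ mldoHom (DirectSum.decompose 𝒮 p m : SkewPolynomialRing serreDerivation))
      (fun m ↦ mldoHom_mem_endWeight (SetLike.coe_mem _)) h hm hmn
    rw [(map_eq_zero_iff _ mldoHom_injective).mp h0]
    exact zero_mem _

/-! ### Ring-theoretic properties -/

instance : IsNoetherianRing mldoAlgebra :=
  have := isNoetherianRing (d := serreDerivation)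
  isNoetherianRing_of_ringEquiv _ mldoEquiv.toRingEquiv

instance : IsNoetherianRing mldoAlgebraᵐᵒᵖ :=
  have := isNoetherianRing_mulOpposite (d := serreDerivation)
  isNoetherianRing_of_ringEquiv _ (RingEquiv.op mldoEquiv.toRingEquiv)

instance : IsDomain mldoAlgebra :=
  mldoEquiv.symm.toMulEquiv.isDomain _

end MLDO

theorem mainTheorem4 :
    -- `ℳ` is the polynomial ring in `E₄` and `E₆`
    Function.Bijective
      (MvPolynomial.aeval ![MLDO.formE₄, MLDO.formE₆] :
        MvPolynomial (Fin 2) ℂ →ₐ[ℂ] MLDO.ModularFormAlgebra) ∧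
    -- `ℳ[ξ; 1, δ]` is graded, with `ξ` of weight `2`
    Nonempty (GradedAlgebra
      (SkewPolynomialRing.weightPiece MLDO.serreDerivation MLDO.formWeight 2)) ∧
    -- `ℳ[ξ; 1, δ]` is isomorphic to `ℛ`, as a graded algebra
    (∃ Φ : SkewPolynomialRing MLDO.serreDerivation ≃ₐ[ℂ] MLDO.mldoAlgebra,
      (Φ (SkewPolynomialRing.C _ MLDO.formE₄) : Module.End ℂ MLDO.H) = MLDO.e₄ ∧
      (Φ (SkewPolynomialRing.C _ MLDO.formE₆) : Module.End ℂ MLDO.H) = MLDO.e₆ ∧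
      (Φ (SkewPolynomialRing.xi _) : Module.End ℂ MLDO.H) = MLDO.delta ∧
      ∀ (n : ℤ) (p : SkewPolynomialRing MLDO.serreDerivation),
        p ∈ SkewPolynomialRing.weightPiece MLDO.serreDerivation MLDO.formWeight 2 n ↔
          Φ p ∈ MLDO.mldoWeight n) ∧
    -- `ℛ` is left and right Noetherian and a left and right Ore domain
    IsNoetherianRing MLDO.mldoAlgebra ∧
    IsNoetherianRing MLDO.mldoAlgebraᵐᵒᵖ ∧
    IsLeftOreDomain MLDO.mldoAlgebra ∧
    IsRightOreDomain MLDO.mldoAlgebra :=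
  ⟨MLDO.aeval_formE₄_formE₆_bijective, MLDO.nonempty_gradedAlgebra_weightPiece,
    ⟨MLDO.mldoEquiv, MLDO.mldoHom_C_formE₄, MLDO.mldoHom_C_formE₆, MLDO.mldoHom_xi,
      MLDO.mem_weightPiece_iff_mldoHom_mem_endWeight⟩,
    inferInstance, inferInstance, IsNoetherianRing.isLeftOreDomain,
    IsNoetherianRing.isLeftOreDomain⟩
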